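/- A permutation $\sigma$ of $\{1,\dots,n\}$ contains a permutation $\pi$ of $\{1,\dots,k\}$ if some subsequence of $\sigma(1)\sigma(2)\cdots\sigma(n)$ is order isomorphic to $\pi(1)\cdots\pi(k)$; otherwise $\sigma$ avoids $\pi$. Let $Av(\pi_1,\dots,\pi_m)$ denote the set of all finite permutations (including the empty one) that avoid each of $\pi_1,\dots,\pi_m$. Let $$\mathcal{H}(z)=\sum_{n\ge 0} |\mathcal{S}_n\cap Av(4123,1324,31524)|\,z^n .$$ Then, as formal power series over $\mathbb{Q}$ (where $\sqrt{1-4z}$ is the power series with constant term $1$ whose square is $1-4z$), $$\mathcal{H}(z)=\frac{3-22z+54z^2-54z^3+25z^4-4z^5-(1-6z+14z^2-16z^3+5z^4)\sqrt{1-4z}}{2\sqrt{1-4z}\,(1-3z+z^2)^2}.$$ Moreover, $Av(4123,1324,31524)$ is an intermediate class, with strict inclusions $$Av(4123,1324,3124)\subsetneq Av(4123,1324,31524)\subsetneq Av(4123,1324),\qquad Av(4123,1324,1423)\subsetneq Av(4123,1324,31524),$$ and it contains asymptotically almost all of $Av(4123,1324)$: $$\lim_{n\to\infty}\frac{|\mathcal{S}_n\cap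 Av(4123,1324,31524)|}{|\mathcal{S}_n\cap Av(4123,1324)|}=1 .$$ -/

import Mathlib

open scoped PowerSeries

/-- Finite permutations of arbitrary length, the permutations of length `n` being the bijections
of `Fin n = {0, …, n - 1}`. -/
abbrev FinPerm : Type := Σ n : ℕ, Equiv.Perm (Fin n)

/-- `σ` contains `π` as a pattern: some subsequence of (the one-line notation of) `σ` is
order isomorphic to `π`. -/
def FinPerm.Contains (σ π : FinPerm) : Prop :=
  ∃ f : Fin π.1 ↪o Fin σ.1, ∀ i j : Fin π.1, π.2 i < π.2 j ↔ σ.2 (f i) < σ.2 (f j)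

/-- The permutation class `Av(B)` of all permutations that contain no element of `B`. -/
def Av (B : Set FinPerm) : Set FinPerm :=
  {σ | ∀ π ∈ B, ¬ σ.Contains π}

/-- The number of permutations of length `n` in `C`. -/
noncomputable def permCount (C : Set FinPerm) (n : ℕ) : ℕ :=
  Nat.card {σ : Equiv.Perm (Fin n) // (⟨n, σ⟩ : FinPerm) ∈ C}

/-- The ordinary generating function of a set of permutations, counted by length. -/
noncomputable def permGenFun (C : Set FinPerm) : ℚ⟦X⟧ :=
  PowerSeries.mk fun n => (permCount C n : ℚ)

/-! The patterns, in one-line notation with values shifted from `{1, …, k}` to `{0, …, k - 1}`. -/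

/-- The permutation 4123. -/
def p4123 : FinPerm := ⟨4, ⟨![3, 0, 1, 2], ![1, 2, 3, 0], by decide, by decide⟩⟩

/-- The permutation 1324. -/
def p1324 : FinPerm := ⟨4, ⟨![0, 2, 1, 3], ![0, 2, 1, 3], by decide, by decide⟩⟩

/-- The permutation 3124. -/
def p3124 : FinPerm := ⟨4, ⟨![2, 0, 1, 3], ![1, 2, 0, 3], by decide, by decide⟩⟩

/-- The permutation 1423. -/
def p1423 : FinPerm := ⟨4, ⟨![0, 3, 1, 2], ![0, 2, 3, 1], by decide, by decide⟩⟩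

/-- The permutation 31524. -/
def p31524 : FinPerm := ⟨5, ⟨![2, 0, 4, 1, 3], ![1, 3, 0, 4, 2], by decide, by decide⟩⟩

/-- The formal power series `√(1 - 4z)`: the binomial series `(1 + z) ^ (1 / 2)` at `-4z`. -/
noncomputable def sqrtOneSubFourX : ℚ⟦X⟧ :=
  PowerSeries.rescale (-4 : ℚ) (PowerSeries.binomialSeries ℚ (1 / 2 : ℚ))

theorem sqrtOneSubFourX_sq : sqrtOneSubFourX ^ 2 = 1 - 4 * PowerSeries.X := by
  have h : PowerSeries.binomialSeries ℚ (1 / 2 : ℚ) ^ 2 = 1 + PowerSeries.X := by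
    rw [sq, ← PowerSeries.binomialSeries_add]
    have := PowerSeries.binomialSeries_nat (R := ℚ) (A := ℚ) 1
    norm_num at this ⊢
    exact this
  rw [sqrtOneSubFourX, ← map_pow, h, map_add, map_one, PowerSeries.rescale_X]
  have h4 : (PowerSeries.C (4 : ℚ)) = (4 : ℚ⟦X⟧) := map_ofNat _ 4
  rw [map_neg, h4, neg_mul, ← sub_eq_add_neg]

theorem constantCoeff_sqrtOneSubFourX : PowerSeries.constantCoeff sqrtOneSubFourX = 1 := by
  rw [sqrtOneSubFourX, ← PowerSeries.coeff_zero_eq_constantCoeff_apply, PowerSeries.coeff_rescale,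
    PowerSeries.coeff_zero_eq_constantCoeff_apply, PowerSeries.binomialSeries_constantCoeff]
  simp

/-!
Permutations are grown by appending a last letter `v` and shifting the letters `≥ v` up by one. A gap
between two consecutive values is open if a letter may be appended there without creating a forbidden
pattern. Both classes, `Av(4123, 1324)` and its subclass avoiding 31524 as well, are treated at once:
the Boolean `ε` says whether 31524 is allowed.

Appending `v` does not affect the gaps below it. Of the gaps above it, the adjacent one survives
exactly if `v` is a sum cut (small values left of large ones, `open_ins_self_succ`), the top one
exactly if it was open and `v` is a skew cut (`IsWord.open_ins_top`), and a gap `g` in between exactly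
if it is open, the values below it form an initial segment of which `v` is a skew cut, and 31524 is
allowed (`IsWord.open_ins_mid`). Hence the numbers of open gaps of each kind, and whether the top gap
is open, form labels of a generating tree with explicit succession rules (`State`,
`extCount_eq_count`).

The generating functions of the subtrees satisfy a linear system. With `C` the Catalan series, so that
`C = 1 + z C²`, it has an explicit solution whose terms are the powers `C ^ m` and `r ^ c`,
`r = (1 - z) / (1 - 2z)`, with coefficients rational in `z` and `C` (`Params.gf`,
`Params.gf_eq_of_isDomain`). Since the system determines its solution coefficientwise, this gives the
generating functions of both classes, where `√(1 - 4z) = 1 - 2zC`.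

The poles at the zeros of `1 - 3z + z²` lie outside the disc of radius `1 / 3`. So the coefficients of
the smaller class are asymptotic to a positive multiple of the central binomial coefficients, the
coefficients of `1 / √(1 - 4z)`, whereas the difference of the two generating functions has the
singular part `√(1 - 4z)` and its coefficients are of smaller order
(`tendsto_coeff_mul_centralBinomSeries`).
-/

section Combinatorics
open List

/-! ### Words and open gaps -/

/-- Makes room for the value `v`: values `≥ v` move up by one. -/
def shiftUp (v a : ℕ) : ℕ := if v ≤ a then a + 1 else a

/-- Appends the value `v` to a word, after making room for it. -/
def ins (L : List ℕ) (v : ℕ) : List ℕ := L.map (shiftUp v) ++ [v]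

/-- The word `L` avoids 4123 and 1324 and, if `ε = false`, also 31524. -/
def Avoids (ε : Bool) (L : List ℕ) : Prop :=
  (∀ a b c d, [a, b, c, d] <+ L → ¬(b < c ∧ c < d ∧ d < a) ∧ ¬(a < c ∧ c < b ∧ b < d)) ∧
    (ε = false → ∀ a b c d e, [a, b, c, d, e] <+ L → ¬(b < d ∧ d < a ∧ a < e ∧ e < c))

/-- The gap `u` (between the values `u - 1` and `u`) of the word `L` is open if appending `u`
completes none of the forbidden patterns. -/
def Open (ε : Bool) (L : List ℕ) (u : ℕ) : Prop :=
  (∀ a b c, [a, b, c] <+ L → ¬(b < c ∧ c < u ∧ u ≤ a) ∧ ¬(a < c ∧ c < b ∧ b < u)) ∧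
    (ε = false → ∀ a b c d, [a, b, c, d] <+ L → ¬(b < d ∧ d < a ∧ a < u ∧ u ≤ c))

theorem shiftUp_lt_shiftUp {v a b : ℕ} : shiftUp v a < shiftUp v b ↔ a < b := by
  unfold shiftUp; split_ifs <;> omega

theorem shiftUp_lt {v a u : ℕ} (h : u ≤ v) : shiftUp v a < u ↔ a < u := by
  unfold shiftUp; split_ifs <;> omega

theorem le_shiftUp {v a u : ℕ} (h : u ≤ v) : u ≤ shiftUp v a ↔ u ≤ a := by
  unfold shiftUp; split_ifs <;> omega

theorem lt_shiftUp {v a : ℕ} : v < shiftUp v a ↔ v ≤ a := by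
  unfold shiftUp; split_ifs <;> omega

theorem shiftUp_lt_succ {v a g : ℕ} (h : v ≤ g) : shiftUp v a < g + 1 ↔ a < g := by
  unfold shiftUp; split_ifs <;> omega

theorem succ_le_shiftUp {v a g : ℕ} (h : v ≤ g) : g + 1 ≤ shiftUp v a ↔ g ≤ a := by
  unfold shiftUp; split_ifs <;> omega

theorem shiftUp_injective (v : ℕ) : Function.Injective (shiftUp v) := fun a b h => by
  unfold shiftUp at h; split_ifs at h <;> omega

/-! The next lemmas split the occurrences of a pattern in `ins L v` into those that avoid the last
letter and those that use it. -/

theorem snoc_sublist_snoc {l L : List ℕ} {x v : ℕ} :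
    l ++ [x] <+ L ++ [v] ↔ l ++ [x] <+ L ∨ x = v ∧ l <+ L := by
  rw [← reverse_sublist, reverse_append, reverse_append]
  simp only [reverse_singleton, singleton_append]
  rw [cons_sublist_cons', reverse_sublist, ← reverse_sublist (l₁ := l ++ [x])]
  simp

theorem pair_sublist_ins {L : List ℕ} {v : ℕ} {p : ℕ → ℕ → Prop} :
    (∀ a b, [a, b] <+ ins L v → p a b) ↔
      (∀ a b, [a, b] <+ L → p (shiftUp v a) (shiftUp v b)) ∧
        ∀ a ∈ L, p (shiftUp v a) v := by
  constructor
  · refine fun h => ⟨fun a b hs => h _ _ ?_, fun a hs => h _ _ ?_⟩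
    · exact (hs.map (shiftUp v)).trans (sublist_append_left _ _)
    · exact ((singleton_sublist.2 hs).map (shiftUp v)).append (Sublist.refl [v])
  · rintro ⟨h1, h2⟩ a b hs
    rcases (snoc_sublist_snoc (l := [a])).1 hs with hs | ⟨rfl, hs⟩ <;>
      obtain ⟨l, hl, he⟩ := sublist_map_iff.1 hs
    · match l, he with
      | [a, b], he => cases he; exact h1 _ _ hl
    · match l, he with
      | [a], he => cases he; exact h2 _ (singleton_sublist.1 hl)

theorem triple_sublist_ins {L : List ℕ} {v : ℕ} {p : ℕ → ℕ → ℕ → Prop} :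
    (∀ a b c, [a, b, c] <+ ins L v → p a b c) ↔
      (∀ a b c, [a, b, c] <+ L → p (shiftUp v a) (shiftUp v b) (shiftUp v c)) ∧
        ∀ a b, [a, b] <+ L → p (shiftUp v a) (shiftUp v b) v := by
  constructor
  · refine fun h => ⟨fun a b c hs => h _ _ _ ?_, fun a b hs => h _ _ _ ?_⟩
    · exact (hs.map (shiftUp v)).trans (sublist_append_left _ _)
    · exact (hs.map (shiftUp v)).append (Sublist.refl [v])
  · rintro ⟨h1, h2⟩ a b c hs
    rcases (snoc_sublist_snoc (l := [a, b])).1 hs with hs | ⟨rfl, hs⟩ <;>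
      obtain ⟨l, hl, he⟩ := sublist_map_iff.1 hs
    · match l, he with
      | [a, b, c], he => cases he; exact h1 _ _ _ hl
    · match l, he with
      | [a, b], he => cases he; exact h2 _ _ hl

theorem quadruple_sublist_ins {L : List ℕ} {v : ℕ} {p : ℕ → ℕ → ℕ → ℕ → Prop} :
    (∀ a b c d, [a, b, c, d] <+ ins L v → p a b c d) ↔
      (∀ a b c d, [a, b, c, d] <+ L →
        p (shiftUp v a) (shiftUp v b) (shiftUp v c) (shiftUp v d)) ∧
        ∀ a b c, [a, b, c] <+ L → p (shiftUp v a) (shiftUp v b) (shiftUp v c) v := by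
  constructor
  · refine fun h => ⟨fun a b c d hs => h _ _ _ _ ?_, fun a b c hs => h _ _ _ _ ?_⟩
    · exact (hs.map (shiftUp v)).trans (sublist_append_left _ _)
    · exact (hs.map (shiftUp v)).append (Sublist.refl [v])
  · rintro ⟨h1, h2⟩ a b c d hs
    rcases (snoc_sublist_snoc (l := [a, b, c])).1 hs with hs | ⟨rfl, hs⟩ <;>
      obtain ⟨l, hl, he⟩ := sublist_map_iff.1 hs
    · match l, he with
      | [a, b, c, d], he => cases he; exact h1 _ _ _ _ hl
    · match l, he with
      | [a, b, c], he => cases he; exact h2 _ _ _ hl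

theorem quintuple_sublist_ins {L : List ℕ} {v : ℕ} {p : ℕ → ℕ → ℕ → ℕ → ℕ → Prop} :
    (∀ a b c d e, [a, b, c, d, e] <+ ins L v → p a b c d e) ↔
      (∀ a b c d e, [a, b, c, d, e] <+ L →
        p (shiftUp v a) (shiftUp v b) (shiftUp v c) (shiftUp v d) (shiftUp v e)) ∧
        ∀ a b c d, [a, b, c, d] <+ L →
          p (shiftUp v a) (shiftUp v b) (shiftUp v c) (shiftUp v d) v := by
  constructor
  · refine fun h => ⟨fun a b c d e hs => h _ _ _ _ _ ?_, fun a b c d hs => h _ _ _ _ _ ?_⟩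
    · exact (hs.map (shiftUp v)).trans (sublist_append_left _ _)
    · exact (hs.map (shiftUp v)).append (Sublist.refl [v])
  · rintro ⟨h1, h2⟩ a b c d e hs
    rcases (snoc_sublist_snoc (l := [a, b, c, d])).1 hs with hs | ⟨rfl, hs⟩ <;>
      obtain ⟨l, hl, he⟩ := sublist_map_iff.1 hs
    · match l, he with
      | [a, b, c, d, e], he => cases he; exact h1 _ _ _ _ _ hl
    · match l, he with
      | [a, b, c, d], he => cases he; exact h2 _ _ _ _ hl

theorem avoids_ins {ε : Bool} {L : List ℕ} {u : ℕ} :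
    Avoids ε (ins L u) ↔ Avoids ε L ∧ Open ε L u := by
  unfold Avoids Open
  rw [quadruple_sublist_ins, quintuple_sublist_ins]
  simp only [shiftUp_lt_shiftUp, shiftUp_lt le_rfl, lt_shiftUp]
  rw [imp_and, and_and_and_comm]

/-- Appending `v` changes nothing for the gaps up to `v`: each of the forbidden patterns ends with an
ascent, so the two last letters of an occurrence cannot be `v` followed by a smaller one. -/
theorem open_ins_of_le {ε : Bool} {L : List ℕ} {u v : ℕ} (h : u ≤ v) :
    Open ε (ins L v) u ↔ Open ε L u := by
  unfold Open
  rw [triple_sublist_ins, quadruple_sublist_ins]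
  simp only [shiftUp_lt_shiftUp, shiftUp_lt le_rfl, lt_shiftUp, le_shiftUp h, shiftUp_lt h]
  constructor
  · exact fun H => ⟨H.1.1, fun he => (H.2 he).1⟩
  · refine fun H => ⟨⟨H.1, fun a b _ => ⟨?_, ?_⟩⟩, fun he => ⟨H.2 he, fun a b c _ => ?_⟩⟩ <;> omega

/-- Appending `v` closes a gap above `v` exactly if `v` plays the role of the letter 2 in a
pattern 312, 132 or 3142 that then becomes relevant for that gap. -/
theorem open_ins_succ {ε : Bool} {L : List ℕ} {v g : ℕ} (h : v ≤ g) :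
    Open ε (ins L v) (g + 1) ↔ Open ε L g ∧
      (∀ a b, [a, b] <+ L → ¬(b < v ∧ g ≤ a) ∧ ¬(a < v ∧ v ≤ b ∧ b < g)) ∧
      (ε = false → ∀ a b c, [a, b, c] <+ L → ¬(b < v ∧ v ≤ a ∧ a < g ∧ g ≤ c)) := by
  have h' : v < g + 1 := by omega
  unfold Open
  rw [triple_sublist_ins, quadruple_sublist_ins]
  simp only [shiftUp_lt_shiftUp, shiftUp_lt le_rfl, lt_shiftUp, shiftUp_lt_succ h,
    succ_le_shiftUp h, h', true_and]
  rw [imp_and, and_and_and_comm]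

/-- `L` is a permutation of `0, …, n - 1`. -/
def IsWord (n : ℕ) (L : List ℕ) : Prop := L ~ List.range n

theorem IsWord.length {n : ℕ} {L : List ℕ} (h : IsWord n L) : L.length = n := by
  simpa using h.length_eq

theorem IsWord.nodup {n : ℕ} {L : List ℕ} (h : IsWord n L) : L.Nodup :=
  h.nodup_iff.2 nodup_range

theorem IsWord.mem {n : ℕ} {L : List ℕ} (h : IsWord n L) {x : ℕ} : x ∈ L ↔ x < n := by
  rw [h.mem_iff, mem_range]

theorem isWord_of_nodup {n : ℕ} {L : List ℕ} (hl : L.length = n) (hn : L.Nodup) (h : ∀ x ∈ L, x < n) :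
    IsWord n L :=
  (hn.subperm fun x hx => mem_range.2 (h x hx)).perm_of_length_le (by simp [hl])

theorem IsWord.ins {n : ℕ} {L : List ℕ} (h : IsWord n L) {v : ℕ} (hv : v ≤ n) :
    IsWord (n + 1) (ins L v) := by
  refine isWord_of_nodup (by simp [_root_.ins, h.length]) ?_ ?_
  · refine Nodup.append (h.nodup.map (shiftUp_injective v)) (by simp) ?_
    simp only [disjoint_singleton, mem_map, not_exists, not_and]
    intro x _ hx
    unfold shiftUp at hx; split_ifs at hx <;> omega
  · simp only [_root_.ins, mem_append, mem_map, mem_singleton]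
    rintro x (⟨y, hy, rfl⟩ | rfl)
    · have := h.mem.1 hy
      unfold shiftUp; split_ifs <;> omega
    · omega

theorem IsWord.pair_total {n : ℕ} {L : List ℕ} (h : IsWord n L) {x y : ℕ} (hx : x < n)
    (hy : y < n) (hxy : x ≠ y) : [x, y] <+ L ∨ [y, x] <+ L := by
  obtain ⟨l₁, l₂, rfl⟩ := append_of_mem (h.mem.2 hy)
  have := h.mem.2 hx
  simp only [mem_append, mem_cons, hxy, false_or] at this
  rcases this with hx | hx
  · left
    exact (singleton_sublist.2 hx).append (singleton_sublist.2 (mem_cons_self))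
  · right
    exact (Sublist.cons_cons y (singleton_sublist.2 hx)).trans (sublist_append_right _ _)

theorem IsWord.triple {n : ℕ} {L : List ℕ} (h : IsWord n L) {x y z : ℕ} (hxy : [x, y] <+ L)
    (hyz : [y, z] <+ L) : [x, y, z] <+ L := by
  have hn := h.nodup
  obtain ⟨l₁, l₂, rfl⟩ := append_of_mem (hxy.subset (by simp : y ∈ [x, y]))
  rw [nodup_append, nodup_cons] at hn
  have hy1 : y ∉ l₁ := fun hy => hn.2.2 y hy y mem_cons_self rfl
  have hz : z ∈ l₂ := by
    rw [sublist_append_iff] at hyz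
    obtain ⟨u₁, u₂, he, h1, h2⟩ := hyz
    match u₁, he with
    | [], he =>
      simp only [nil_append] at he; subst he
      exact singleton_sublist.1 (cons_sublist_cons.1 h2)
    | a :: u, he =>
      simp only [cons_append, cons.injEq] at he
      exact absurd (h1.subset (by simp [he.1])) hy1
  have hx : x ∈ l₁ := by
    rw [sublist_append_iff] at hxy
    obtain ⟨u₁, u₂, he, h1, h2⟩ := hxy
    match u₁, he with
    | [], he =>
      simp only [nil_append] at he; subst he
      rcases cons_sublist_cons'.1 h2 with h2 | h2
      · exact absurd (h2.subset (by simp : y ∈ [x, y])) hn.2.1.1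
      · exact absurd (singleton_sublist.1 h2.2) hn.2.1.1
    | a :: u, he =>
      simp only [cons_append, cons.injEq] at he
      exact h1.subset (by simp [he.1])
  exact (singleton_sublist.2 hx).append (Sublist.cons_cons y (singleton_sublist.2 hz))

/-- The gap `u` is a sum cut: all values `< u` stand to the left of all values `≥ u`. -/
def SumCut (L : List ℕ) (u : ℕ) : Prop := ∀ a b, [a, b] <+ L → ¬(b < u ∧ u ≤ a)

/-- The gap `u` is a skew cut: all values `≥ u` stand to the left of all values `< u`. -/
def SkewCut (L : List ℕ) (u : ℕ) : Prop := ∀ a b, [a, b] <+ L → ¬(a < u ∧ u ≤ b)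

/-- The gap `g` is a sum cut, and `u` is a skew cut of the part of the word below `g`. -/
def NestedCut (L : List ℕ) (u g : ℕ) : Prop :=
  SumCut L g ∧ ∀ a b, [a, b] <+ L → ¬(a < u ∧ u ≤ b ∧ b < g)

section
variable {ε : Bool} {n : ℕ} {L : List ℕ} {u v g : ℕ}

theorem sumCut_ins (h : u ≤ v) : SumCut (ins L v) u ↔ SumCut L u := by
  unfold SumCut
  rw [pair_sublist_ins]
  simp only [shiftUp_lt h, le_shiftUp h]
  exact and_iff_left (fun a _ => by omega)

theorem nestedCut_ins (h : u ≤ v) (h' : g ≤ v) : NestedCut (ins L v) u g ↔ NestedCut L u g := by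
  unfold NestedCut
  rw [sumCut_ins h', pair_sublist_ins]
  simp only [shiftUp_lt h, le_shiftUp h, shiftUp_lt h']
  exact and_congr_right fun _ => and_iff_left (fun a _ => by omega)

theorem skewCut_ins_zero : SkewCut (ins L 0) (u + 1) ↔ SkewCut L u := by
  unfold SkewCut
  rw [pair_sublist_ins]
  simp only [shiftUp_lt_succ (Nat.zero_le u), succ_le_shiftUp (Nat.zero_le u)]
  exact and_iff_left (fun a _ => by omega)

theorem skewCut_zero : SkewCut L 0 := fun a b _ => by omega

theorem IsWord.not_sumCut_ins (hL : IsWord n L) (h : v < u) (hu : u ≤ n) :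
    ¬SumCut (_root_.ins L v) u := by
  unfold SumCut
  rw [pair_sublist_ins]
  intro H
  refine H.2 (n - 1) (hL.mem.2 (by omega)) ⟨h, ?_⟩
  unfold shiftUp; split_ifs <;> omega

theorem IsWord.not_skewCut_ins (hL : IsWord n L) (hn : 0 < n) (h0 : 0 < u) (h : u ≤ v) :
    ¬SkewCut (_root_.ins L v) u := by
  unfold SkewCut
  rw [pair_sublist_ins]
  intro H
  refine H.2 0 (hL.mem.2 hn) ⟨?_, h⟩
  unfold shiftUp; split_ifs <;> omega

theorem IsWord.open_ins_top (hL : IsWord n L) (hv : v ≤ n) :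
    Open ε (_root_.ins L v) (n + 1) ↔ Open ε L n ∧ SkewCut L v := by
  have hm : ∀ {l : List ℕ} {x : ℕ}, l <+ L → x ∈ l → x < n :=
    fun h hx => hL.mem.1 (h.subset hx)
  rw [open_ins_succ hv]
  refine and_congr_right fun _ => ⟨fun H a b hs => ?_, fun H => ⟨fun a b hs => ⟨?_, ?_⟩, ?_⟩⟩
  · have := (H.1 a b hs).2
    have := hm hs (by simp : b ∈ [a, b])
    omega
  · have := hm hs (by simp : a ∈ [a, b])
    omega
  · have := H a b hs
    omega
  · intro _ a b c hs
    have := hm hs (by simp : c ∈ [a, b, c])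
    omega

theorem open_ins_self_succ : Open ε (ins L v) (v + 1) ↔ Open ε L v ∧ SumCut L v := by
  rw [open_ins_succ le_rfl]
  refine and_congr_right fun _ => ⟨fun H a b hs => (H.1 a b hs).1, fun H => ⟨fun a b hs =>
    ⟨H a b hs, ?_⟩, fun _ a b c _ => ?_⟩⟩ <;> omega

/-- The gaps strictly between `v` and the top get closed, except for the sum cut of a nested cut, and
that one gets closed as well if 31524 is forbidden. This is the only place where the two classes
differ. -/
theorem IsWord.open_ins_mid (hL : IsWord n L) (hv : 0 < v) (hg : v < g) (hn : g < n) :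
    Open ε (_root_.ins L v) (g + 1) ↔ ε = true ∧ Open ε L g ∧ NestedCut L v g := by
  rw [open_ins_succ hg.le]
  constructor
  · rintro ⟨ho, H, H'⟩
    -- The values `v`, `0`, `g` occur in this order, forming with the appended letter the pattern
    -- 31524 without its last letter.
    have h2 : [0, g] <+ L :=
      (hL.pair_total (by omega) hn (by omega)).resolve_right fun h => (H _ _ h).1 (by omega)
    have h1 : [v, 0] <+ L :=
      (hL.pair_total (by omega) (by omega) (by omega)).resolve_right
        fun h => (H _ _ h).2 (by omega)
    refine ⟨?_, ho, fun a b hs hab => ?_, fun a b hs => (H a b hs).2⟩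
    · cases ε
      · exact absurd (by omega) (H' rfl _ _ _ (hL.triple h1 h2))
      · rfl
    · by_cases hb : b < v
      · exact (H a b hs).1 (by omega)
      · have h3 : [b, 0] <+ L :=
          (hL.pair_total (by omega) (by omega) (by omega)).resolve_right
            fun h => (H _ _ h).2 (by omega)
        have h4 : [a, 0] <+ L := (by simp : [a, 0] <+ [a, b, 0]).trans (hL.triple hs h3)
        exact (H _ _ h4).1 (by omega)
  · rintro ⟨rfl, ho, H1, H2⟩
    refine ⟨ho, fun a b hs => ⟨fun h => H1 a b hs (by omega), H2 a b hs⟩, by simp⟩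

theorem IsWord.not_skewCut_of_sumCut (hL : IsWord n L) (h0 : 0 < u) (hu : u < n)
    (h : SumCut L u) : ¬SkewCut L u := fun h' => by
  rcases hL.pair_total (x := 0) (y := u) (by omega) hu (by omega) with hs | hs
  · exact h' _ _ hs (by omega)
  · exact h _ _ hs (by omega)

theorem IsWord.not_sumCut_of_nestedCut (hL : IsWord n L) (h0 : 0 < u) (hug : u < g) (hu : u < n)
    (h : NestedCut L u g) : ¬SumCut L u := fun h' => by
  rcases hL.pair_total (x := 0) (y := u) (by omega) hu (by omega) with hs | hs
  · exact h.2 _ _ hs (by omega)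
  · exact h' _ _ hs (by omega)

theorem IsWord.not_skewCut_of_nestedCut (hL : IsWord n L) (h0 : 0 < u) (hug : u < g) (hg : g < n)
    (h : NestedCut L u g) : ¬SkewCut L u := fun h' => by
  rcases hL.pair_total (x := 0) (y := g) (by omega) hg (by omega) with hs | hs
  · exact h' _ _ hs (by omega)
  · exact h.1 _ _ hs (by omega)

/-- In a nested cut, the sum cut is the lowest one above the skew cut. -/
theorem IsWord.le_of_nestedCut (hL : IsWord n L) (h0 : 0 < u) (huv : u < v) (hv : v < n)
    (h : NestedCut L u g) (h' : SumCut L v) : g ≤ v := by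
  by_contra hgv
  rcases hL.pair_total (x := 0) (y := v) (by omega) hv (by omega) with hs | hs
  · exact h.2 _ _ hs (by omega)
  · exact h' _ _ hs (by omega)

theorem IsWord.nestedCut_top (hL : IsWord n L) : NestedCut L u n ↔ SkewCut L u := by
  have hm : ∀ {l : List ℕ} {x : ℕ}, l <+ L → x ∈ l → x < n :=
    fun h hx => hL.mem.1 (h.subset hx)
  constructor
  · intro h a b hs
    have := h.2 a b hs
    have := hm hs (by simp : b ∈ [a, b])
    omega
  · refine fun h => ⟨fun a b hs => ?_, fun a b hs => ?_⟩
    · have := hm hs (by simp : a ∈ [a, b])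
      omega
    · have := h a b hs
      omega

theorem IsWord.sumCut_top (hL : IsWord n L) : SumCut L n := fun a b hs => by
  have := hL.mem.1 (hs.subset (by simp : a ∈ [a, b]))
  omega

end

/-! ### The list of open gaps -/

section Gaps
open Classical in
/-- The open gaps strictly between the bottom gap and the top gap, in increasing order. -/
noncomputable def gaps (ε : Bool) (L : List ℕ) : List ℕ :=
  (List.range' 1 (L.length - 1)).filter (fun u => Open ε L u)

open Classical in
/-- The number of ways to append `k` further letters to `L` without creating a forbidden
pattern. -/
noncomputable def extCount (ε : Bool) : ℕ → List ℕ → ℕ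
  | 0, _ => 1
  | k + 1, L => (((List.range (L.length + 1)).filter (fun u => Open ε L u)).map
      (fun v => extCount ε k (ins L v))).sum

variable {ε : Bool} {n m : ℕ} {L : List ℕ} {u v g : ℕ}

theorem open_zero : Open ε L 0 :=
  ⟨fun a b c _ => by omega, fun _ a b c d _ => by omega⟩

theorem IsWord.mem_gaps (hL : IsWord (m + 1) L) : u ∈ gaps ε L ↔ (0 < u ∧ u < m + 1) ∧ Open ε L u := by
  classical
  simp only [gaps, mem_filter, mem_range'_1, hL.length, decide_eq_true_eq]
  refine and_congr_left fun _ => ?_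
  omega

theorem pairwise_gaps : (gaps ε L).Pairwise (· < ·) :=
  (pairwise_lt_range' (s := 1)).sublist filter_sublist

open Classical in
theorem IsWord.extCount_succ (hL : IsWord (m + 1) L) (k : ℕ) :
    extCount ε (k + 1) L = extCount ε k (_root_.ins L 0) +
      ((gaps ε L).map fun v => extCount ε k (_root_.ins L v)).sum +
      if Open ε L (m + 1) then extCount ε k (_root_.ins L (m + 1)) else 0 := by
  have h : List.range (m + 1 + 1) = 0 :: (List.range' 1 m ++ [m + 1]) := by
    rw [range_eq_range', range'_succ, range'_concat]
    simp [add_comm]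
  rw [extCount, hL.length, h, filter_cons_of_pos (by simpa using open_zero), filter_append,
    filter_singleton, gaps, hL.length]
  by_cases ho : Open ε L (m + 1) <;> simp [ho, add_assoc]

theorem gaps_ins_zero (hL : IsWord (m + 1) L) :
    gaps ε (ins L 0) = (0 :: gaps ε L).map (· + 1) := by
  classical
  have h : 0 :: gaps ε L = (List.range' 0 (m + 1)).filter (fun u => Open ε L u) := by
    rw [range'_succ, filter_cons_of_pos (by simpa using open_zero), gaps, hL.length]
    simp
  have h1 : List.range' 1 (m + 1) = (List.range' 0 (m + 1)).map (· + 1) := by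
    exact range'_succ_left (s := 0)
  rw [h, gaps, (hL.ins (Nat.zero_le _)).length, Nat.add_sub_cancel, h1, filter_map]
  congr 1
  refine filter_congr fun u _ => ?_
  simp only [Function.comp, decide_eq_decide]
  rw [open_ins_succ (Nat.zero_le u)]
  refine and_iff_left ⟨fun a b _ => by omega, fun _ a b c _ => by omega⟩

theorem gaps_ins_top (hL : IsWord (m + 1) L) (ho : Open ε L (m + 1)) :
    gaps ε (ins L (m + 1)) = gaps ε L ++ [m + 1] := by
  classical
  rw [gaps, (hL.ins le_rfl).length, gaps, hL.length, Nat.add_sub_cancel, Nat.add_sub_cancel,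
    range'_concat, filter_append, filter_singleton]
  congr 1
  · refine filter_congr fun u hu => ?_
    rw [mem_range'_1] at hu
    rw [decide_eq_decide, open_ins_of_le (by omega)]
  · simp [open_ins_of_le, ho, add_comm 1 m]

theorem gaps_ins_mid (hL : IsWord (m + 1) L) {l₁ l₂ : List ℕ} (h : gaps ε L = l₁ ++ v :: l₂) :
    ∃ l, gaps ε (ins L v) = l₁ ++ v :: l ∧ l.Pairwise (· < ·) ∧
      ∀ u, u ∈ l ↔ (v < u ∧ u < m + 2) ∧ Open ε (ins L v) u := by
  classical
  have hv := hL.mem_gaps.1 (show v ∈ gaps ε L by simp [h])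
  have hs := pairwise_gaps (ε := ε) (L := L)
  rw [h, pairwise_append, pairwise_cons] at hs
  refine ⟨(List.range' (v + 1) (m + 1 - v)).filter (fun u => Open ε (ins L v) u), ?_,
    (pairwise_lt_range' (s := v + 1)).sublist filter_sublist, fun u => ?_⟩
  · have key : (List.range' 1 v).filter (fun u => Open ε L u) = l₁ ++ [v] := by
      have h1 := congrArg (List.filter (fun u => decide (u ≤ v))) h
      have h2 : l₁.filter (fun u => decide (u ≤ v)) = l₁ :=
        filter_eq_self.2 fun a ha => by simpa using (hs.2.2 a ha v mem_cons_self).le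
      have h3 : l₂.filter (fun u => decide (u ≤ v)) = [] :=
        filter_eq_nil_iff.2 fun a ha => by simpa using hs.2.1.1 a ha
      rw [filter_append, h2, filter_cons_of_pos (by simp), h3, gaps, hL.length] at h1
      have h4 : List.range' 1 (m + 1 - 1) = List.range' 1 v ++ List.range' (1 + v) (m - v) := by
        rw [range'_append_1]; congr 1; omega
      rw [h4, filter_append, filter_append] at h1
      have h5 : ((List.range' (1 + v) (m - v)).filter (fun u => decide (Open ε L u))).filter
          (fun u => decide (u ≤ v)) = [] := by
        refine filter_eq_nil_iff.2 fun a ha => ?_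
        have := mem_range'_1.1 (mem_of_mem_filter ha)
        simp only [decide_eq_true_eq]; omega
      have h6 : ((List.range' 1 v).filter (fun u => decide (Open ε L u))).filter
          (fun u => decide (u ≤ v)) = (List.range' 1 v).filter (fun u => decide (Open ε L u)) := by
        refine filter_eq_self.2 fun a ha => ?_
        have := mem_range'_1.1 (mem_of_mem_filter ha)
        simp only [decide_eq_true_eq]; omega
      rwa [h5, h6, append_nil] at h1
    have h4 : List.range' 1 (m + 1) = List.range' 1 v ++ List.range' (v + 1) (m + 1 - v) := by
      rw [add_comm v 1, range'_append_1]; congr 1; omega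
    rw [gaps, (hL.ins (by omega)).length, Nat.add_sub_cancel, h4, filter_append,
      show l₁ ++ v :: filter (fun u => decide (Open ε (ins L v) u)) (range' (v + 1) (m + 1 - v)) =
        (l₁ ++ [v]) ++ filter (fun u => decide (Open ε (ins L v) u)) (range' (v + 1) (m + 1 - v))
        by simp, ← key]
    congr 1
    refine filter_congr fun u hu => ?_
    rw [mem_range'_1] at hu
    rw [decide_eq_decide, open_ins_of_le (by omega)]
  · simp only [mem_filter, mem_range'_1, decide_eq_true_eq]
    refine and_congr_left fun _ => ?_
    omega

theorem eq_nil_of_forall {l : List ℕ} {p : ℕ → Prop} (h : ∀ u, u ∈ l ↔ p u) (h' : ∀ u, ¬p u) :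
    l = [] :=
  eq_nil_iff_forall_not_mem.2 fun u hu => h' u ((h u).1 hu)

theorem eq_singleton_of_pairwise {l : List ℕ} (hl : l.Pairwise (· < ·)) {x : ℕ}
    (h : ∀ u, u ∈ l ↔ u = x) : l = [x] := by
  match l, hl, h with
  | [], _, h => simpa using h x
  | [a], _, h => rw [(h a).1 (by simp)]
  | a :: b :: l, hl, h =>
    have h1 := (h a).1 (by simp)
    have h2 := (h b).1 (by simp)
    have := (pairwise_cons.1 hl).1 b (by simp)
    omega

/-- The open gaps of `ins L v` above `v`: for a sum cut `v`, just the one next to `v`. -/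
theorem gaps_ins_of_sumCut (hL : IsWord (m + 1) L) {l₁ l₂ : List ℕ}
    (h : gaps ε L = l₁ ++ v :: l₂) (hv : SumCut L v) :
    gaps ε (ins L v) = l₁ ++ [v, v + 1] := by
  obtain ⟨l, hl, hp, hm⟩ := gaps_ins_mid hL h
  have hv' := hL.mem_gaps.1 (show v ∈ gaps ε L by simp [h])
  rw [hl, eq_singleton_of_pairwise hp]
  intro u
  rw [hm]
  constructor
  · rintro ⟨⟨h1, h2⟩, h3⟩
    by_contra hu
    obtain ⟨g, rfl⟩ : ∃ g, u = g + 1 := ⟨u - 1, by omega⟩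
    have := ((hL.open_ins_mid (by omega) (by omega) (by omega)).1 h3).2.2
    exact hL.not_sumCut_of_nestedCut (by omega) (show v < g by omega) (by omega) this hv
  · rintro rfl
    exact ⟨by omega, open_ins_self_succ.2 ⟨hv'.2, hv⟩⟩

/-- If `v` is neither a sum cut nor the lower part of a nested cut, all gaps strictly between `v`
and the top gap get closed. -/
theorem gaps_ins_of_not (hL : IsWord (m + 1) L) {l₁ l₂ : List ℕ}
    (h : gaps ε L = l₁ ++ v :: l₂) (hv : ¬SumCut L v)
    (hg : ε = true → ∀ g ∈ gaps ε L, v < g → ¬NestedCut L v g) :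
    gaps ε (ins L v) = l₁ ++ [v] := by
  obtain ⟨l, hl, hp, hm⟩ := gaps_ins_mid hL h
  have hv' := hL.mem_gaps.1 (show v ∈ gaps ε L by simp [h])
  rw [hl, eq_nil_of_forall hm]
  rintro u ⟨⟨h1, h2⟩, h3⟩
  obtain ⟨g, rfl⟩ : ∃ g, u = g + 1 := ⟨u - 1, by omega⟩
  rcases Nat.eq_or_lt_of_le (show v ≤ g by omega) with rfl | hvg
  · exact hv (open_ins_self_succ.1 h3).2
  · obtain ⟨he, ho, hn⟩ := (hL.open_ins_mid (by omega) hvg (by omega)).1 h3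
    exact hg he g (hL.mem_gaps.2 ⟨by omega, ho⟩) hvg hn

theorem gaps_ins_of_nestedCut (hL : IsWord (m + 1) L) {l₁ l₂ : List ℕ}
    (h : gaps true L = l₁ ++ v :: l₂) (hg : g ∈ gaps true L) (hvg : v < g)
    (hn : NestedCut L v g) : gaps true (ins L v) = l₁ ++ [v, g + 1] := by
  obtain ⟨l, hl, hp, hm⟩ := gaps_ins_mid hL h
  have hv' := hL.mem_gaps.1 (show v ∈ gaps true L by simp [h])
  have hg' := hL.mem_gaps.1 hg
  rw [hl, eq_singleton_of_pairwise hp]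
  intro u
  rw [hm]
  constructor
  · rintro ⟨⟨h1, h2⟩, h3⟩
    obtain ⟨g', rfl⟩ : ∃ g, u = g + 1 := ⟨u - 1, by omega⟩
    rcases Nat.eq_or_lt_of_le (show v ≤ g' by omega) with rfl | hvg'
    · exact absurd (open_ins_self_succ.1 h3).2
        (hL.not_sumCut_of_nestedCut (by omega) hvg (by omega) hn)
    · obtain ⟨-, ho, hn'⟩ := (hL.open_ins_mid (by omega) hvg' (by omega)).1 h3
      have h4 := hL.le_of_nestedCut (by omega) hvg (by omega) hn' hn.1
      have h5 := hL.le_of_nestedCut (by omega) hvg' (by omega) hn hn'.1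
      omega
  · rintro rfl
    exact ⟨by omega, (hL.open_ins_mid (by omega) hvg (by omega)).2 ⟨rfl, hg'.2, hn⟩⟩

end Gaps

/-! ### The generating tree -/

/-- The labels of the generating tree. They record how many open gaps of each kind a word has
between the bottom gap, which is always open, and the top gap. -/
inductive State
  /-- The top gap is closed, there are `m` open gaps and none of them is a sum cut. -/
  | W (m : ℕ)
  /-- The top gap is closed; in increasing order there are `a` nested cuts, `b` other gaps, `c` sum
  cuts and one further gap. -/
  | Y (a b c : ℕ)
  /-- The top gap is open; in increasing order there are `a` nested cuts, `b` other gaps and `c`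
  sum cuts. -/
  | X (a b c : ℕ)
  /-- The top gap is open; in increasing order there are `a` skew cuts and `b` other gaps. -/
  | V (a b : ℕ)

/-- The labels of the children of a node, the child made by the bottom gap first. -/
def State.children (ε : Bool) : State → List State
  | W m => W (m + 1) :: (List.range m).map fun i => W (i + 1)
  | Y a b c => W (a + b + c + 2) :: ((List.range a).map (fun i => W (i + 1 + ε.toNat)) ++
      (List.range b).map (fun i => W (a + i + 1)) ++
      (List.range c).map (fun j => Y a b (j + 1)) ++ [Y a b c])
  | X a b c => V 1 (a + b + c) :: ((List.range a).map (fun i => W (i + 1 + ε.toNat)) ++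
      (List.range b).map (fun i => W (a + i + 1)) ++
      (List.range c).map (fun j => Y a b (j + 1)) ++ [X a b (c + 1)])
  | V a b => V (a + 1) b :: ((List.range a).map (fun i => X 0 (i + 1) 0) ++
      (List.range b).map (fun i => W (a + i + 1)) ++ [X a b 1])

/-- The number of nodes `k` levels below a node with the given label. -/
def State.count (ε : Bool) : ℕ → State → ℕ
  | 0, _ => 1
  | k + 1, s => ((s.children ε).map (State.count ε k)).sum

/-- The word `L` has the given label. -/
inductive HasState (ε : Bool) (L : List ℕ) : State → Prop
  | w {l : List ℕ} (hg : gaps ε L = l) (htop : ¬Open ε L L.length)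
      (hl : ∀ u ∈ l, ¬SumCut L u) : HasState ε L (.W l.length)
  | y {lq lo ls : List ℕ} {x : ℕ} (hg : gaps ε L = lq ++ lo ++ ls ++ [x])
      (htop : ¬Open ε L L.length) (hq : ∀ u ∈ lq, ∃ g ∈ ls, NestedCut L u g)
      (ho : ∀ u ∈ lo, ¬SumCut L u ∧ ∀ g ∈ ls, ¬NestedCut L u g) (hs : ∀ u ∈ ls, SumCut L u)
      (hx : ¬SumCut L x) : HasState ε L (.Y lq.length lo.length ls.length)
  | x {lq lo ls : List ℕ} (hg : gaps ε L = lq ++ lo ++ ls)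
      (htop : Open ε L L.length) (hq : ∀ u ∈ lq, ∃ g ∈ ls, NestedCut L u g)
      (ho : ∀ u ∈ lo, ¬SumCut L u ∧ ¬SkewCut L u ∧ ∀ g ∈ ls, ¬NestedCut L u g)
      (hs : ∀ u ∈ ls, SumCut L u) : HasState ε L (.X lq.length lo.length ls.length)
  | v {lk lo : List ℕ} (hg : gaps ε L = lk ++ lo) (htop : Open ε L L.length)
      (hk : ∀ u ∈ lk, SkewCut L u) (ho : ∀ u ∈ lo, ¬SumCut L u ∧ ¬SkewCut L u) :
      HasState ε L (.V lk.length lo.length)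

theorem sum_map_eq_sum_range {l : List ℕ} {f g : ℕ → ℕ}
    (h : ∀ l₁ v l₂, l = l₁ ++ v :: l₂ → f v = g l₁.length) :
    (l.map f).sum = ((List.range l.length).map g).sum := by
  induction l using List.reverseRecOn with
  | nil => simp
  | append_singleton l x ih =>
    rw [map_append, sum_append, length_append, length_singleton, range_succ, map_append,
      sum_append, ih fun l₁ v l₂ hl => h l₁ v (l₂ ++ [x]) (by simp [hl])]
    simp [h l x [] rfl]

section Transitions
variable {ε : Bool} {m v : ℕ} {L : List ℕ}

theorem lt_of_pairwise {l₁ l₂ : List ℕ} (h : (l₁ ++ l₂).Pairwise (· < ·)) {a b : ℕ} (ha : a ∈ l₁)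
    (hb : b ∈ l₂) : a < b :=
  (pairwise_append.1 h).2.2 a ha b hb

/-- Appending `v` leads to a label `W` if no gap up to `v` is a sum cut and the top gap gets (or
stays) closed: sum cuts above `v` are destroyed by the letter `v`. -/
theorem hasState_ins_w (hL : IsWord (m + 1) L) {l₁ l₂ r : List ℕ}
    (h : gaps ε L = l₁ ++ v :: l₂) (h' : gaps ε (ins L v) = l₁ ++ v :: r)
    (hl : ∀ u ∈ l₁, ¬SumCut L u) (hv : ¬SumCut L v) (ht : ¬(Open ε L (m + 1) ∧ SkewCut L v)) :
    HasState ε (ins L v) (.W (l₁ ++ v :: r).length) := by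
  have hv' := hL.mem_gaps.1 (show v ∈ gaps ε L by simp [h])
  have hL' := hL.ins (show v ≤ m + 1 by omega)
  have hp := pairwise_gaps (ε := ε) (L := L)
  have hp' := pairwise_gaps (ε := ε) (L := ins L v)
  rw [h'] at hp'
  rw [h] at hp
  refine .w h' ?_ fun u hu => ?_
  · rwa [hL'.length, hL.open_ins_top (by omega)]
  · have hu' := hL'.mem_gaps.1 (h' ▸ hu)
    rw [mem_append, mem_cons] at hu
    rcases hu with hu | rfl | hu
    · rw [sumCut_ins (lt_of_pairwise hp hu mem_cons_self).le]
      exact hl u hu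
    · rwa [sumCut_ins le_rfl]
    · exact hL.not_sumCut_ins ((pairwise_cons.1 (pairwise_append.1 hp').2.1).1 u hu) (by omega)

theorem hasState_ins_zero_w (hL : IsWord (m + 1) L) (ht : ¬Open ε L (m + 1)) :
    HasState ε (ins L 0) (.W ((gaps ε L).length + 1)) := by
  have hL' := hL.ins (Nat.zero_le _)
  have h := HasState.w (gaps_ins_zero (ε := ε) hL) (by
    rw [hL'.length, hL.open_ins_top (Nat.zero_le _)]; tauto) fun u hu => by
      rw [← gaps_ins_zero hL, hL'.mem_gaps] at hu
      exact hL.not_sumCut_ins (by omega) (by omega)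
  simpa using h

/-- Appending `0` creates one new skew cut, preserves the old ones and destroys all sum cuts. -/
theorem hasState_ins_zero_v (hL : IsWord (m + 1) L) (ht : Open ε L (m + 1)) {lk lo : List ℕ}
    (hg : gaps ε L = lk ++ lo) (hk : ∀ u ∈ lk, SkewCut L u) (ho : ∀ u ∈ lo, ¬SkewCut L u) :
    HasState ε (ins L 0) (.V (lk.length + 1) lo.length) := by
  have hL' := hL.ins (Nat.zero_le _)
  have h0 := gaps_ins_zero (ε := ε) hL
  have h := HasState.v (ε := ε) (L := ins L 0) (lk := (0 :: lk).map (· + 1))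
    (lo := lo.map (· + 1)) (by rw [h0, hg]; simp)
    (by rw [hL'.length, hL.open_ins_top (Nat.zero_le _)]; exact ⟨ht, skewCut_zero⟩)
    (fun u hu => by
      obtain ⟨w, hw, rfl⟩ := mem_map.1 hu
      rw [skewCut_ins_zero]
      rcases mem_cons.1 hw with rfl | hw
      · exact skewCut_zero
      · exact hk w hw)
    (fun u hu => by
      obtain ⟨w, hw, rfl⟩ := mem_map.1 hu
      have := hL.mem_gaps.1 (show w ∈ gaps ε L by simp [hg, hw])
      exact ⟨hL.not_sumCut_ins (by omega) (by omega), by rw [skewCut_ins_zero]; exact ho w hw⟩)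
  simpa using h

/-- Inserting at a sum cut closes the top gap and all gaps above `v` but the one next to `v`. Nested
cuts survive, because their sum cut is the lowest one. -/
theorem hasState_ins_sum (hL : IsWord (m + 1) L) {lq lo l₁ l₂ : List ℕ}
    (h : gaps ε L = lq ++ lo ++ l₁ ++ v :: l₂)
    (hq : ∀ u ∈ lq, ∃ g ∈ l₁ ++ v :: l₂, NestedCut L u g)
    (ho : ∀ u ∈ lo, ¬SumCut L u ∧ ∀ g ∈ l₁ ++ [v], ¬NestedCut L u g)
    (hs : ∀ u ∈ l₁ ++ [v], SumCut L u) :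
    HasState ε (ins L v) (.Y lq.length lo.length (l₁.length + 1)) := by
  have hv' := hL.mem_gaps.1 (show v ∈ gaps ε L by simp [h])
  have hL' := hL.ins (show v ≤ m + 1 by omega)
  have hp := pairwise_gaps (ε := ε) (L := L)
  have hv := hs v (by simp)
  rw [h] at hp
  have hle : ∀ u ∈ l₁ ++ [v], u ≤ v := fun u hu => by
    rcases mem_append.1 hu with hu | hu
    · exact (lt_of_pairwise hp (by simp [hu]) mem_cons_self).le
    · simp at hu; omega
  have := HasState.y (ε := ε) (L := ins L v) (lq := lq) (lo := lo) (ls := l₁ ++ [v]) (x := v + 1)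
    (by rw [gaps_ins_of_sumCut hL h hv]; simp)
    (by
      rw [hL'.length, hL.open_ins_top (by omega)]
      exact fun H => hL.not_skewCut_of_sumCut (by omega) (by omega) hv H.2)
    (fun u hu => by
      obtain ⟨g, hg, hn⟩ := hq u hu
      have huv : u < v := lt_of_pairwise hp (by simp [hu]) mem_cons_self
      have hu' := hL.mem_gaps.1 (show u ∈ gaps ε L by simp [h, hu])
      have hgv := hL.le_of_nestedCut (by omega) huv (by omega) hn hv
      refine ⟨g, ?_, (nestedCut_ins huv.le hgv).2 hn⟩
      simp only [mem_append, mem_cons] at hg ⊢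
      rcases hg with hg | hg | hg
      · exact .inl hg
      · exact .inr (by simp [hg])
      · exact absurd ((pairwise_cons.1 (pairwise_append.1 hp).2.1).1 g hg) (by omega))
    (fun u hu => by
      have huv : u < v := lt_of_pairwise hp (by simp [hu]) mem_cons_self
      rw [sumCut_ins huv.le]
      refine ⟨(ho u hu).1, fun g hg => ?_⟩
      rw [nestedCut_ins huv.le (hle g hg)]
      exact (ho u hu).2 g hg)
    (fun u hu => by rw [sumCut_ins (hle u hu)]; exact hs u hu)
    (hL.not_sumCut_ins (by omega) (by omega))
  simpa using this

/-- Appending the maximum makes the old top gap a sum cut, and every skew cut a nested cut. -/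
theorem hasState_ins_top (hL : IsWord (m + 1) L) (ht : Open ε L (m + 1)) {lq lo ls : List ℕ}
    (h : gaps ε L = lq ++ lo ++ ls) (hq : ∀ u ∈ lq, ∃ g ∈ ls ++ [m + 1], NestedCut L u g)
    (ho : ∀ u ∈ lo, ¬SumCut L u ∧ ¬SkewCut L u ∧ ∀ g ∈ ls, ¬NestedCut L u g)
    (hs : ∀ u ∈ ls, SumCut L u) :
    HasState ε (ins L (m + 1)) (.X lq.length lo.length (ls.length + 1)) := by
  have hL' := hL.ins (le_refl (m + 1))
  have hle : ∀ u ∈ gaps ε L, 0 < u ∧ u ≤ m + 1 := fun u hu => by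
    have := hL.mem_gaps.1 hu; omega
  have hle' : ∀ u ∈ ls ++ [m + 1], u ≤ m + 1 := fun u hu => by
    rcases mem_append.1 hu with hu | hu
    · exact (hle u (by simp [h, hu])).2
    · simp at hu; omega
  have := HasState.x (ε := ε) (L := ins L (m + 1)) (lq := lq) (lo := lo) (ls := ls ++ [m + 1])
    (by rw [gaps_ins_top hL ht, h]; simp)
    (by
      rw [hL'.length, hL.open_ins_top le_rfl]
      exact ⟨ht, hL.nestedCut_top.1 ⟨hL.sumCut_top, fun a b hs => by
        have := hL.mem.1 (hs.subset (by simp : a ∈ [a, b]))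
        have := hL.mem.1 (hs.subset (by simp : b ∈ [a, b]))
        omega⟩⟩)
    (fun u hu => by
      obtain ⟨g, hg, hn⟩ := hq u hu
      exact ⟨g, hg, (nestedCut_ins (hle u (by simp [h, hu])).2 (hle' g hg)).2 hn⟩)
    (fun u hu => by
      have huv := hle u (by simp [h, hu])
      rw [sumCut_ins huv.2]
      refine ⟨(ho u hu).1, hL.not_skewCut_ins (by omega) huv.1 huv.2, fun g hg => ?_⟩
      rw [nestedCut_ins huv.2 (hle' g hg)]
      rcases mem_append.1 hg with hg | hg
      · exact (ho u hu).2.2 g hg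
      · rw [mem_singleton.1 hg, hL.nestedCut_top]
        exact (ho u hu).2.1)
    (fun u hu => by
      rw [sumCut_ins (hle' u hu)]
      rcases mem_append.1 hu with hu | hu
      · exact hs u hu
      · rw [mem_singleton.1 hu]; exact hL.sumCut_top)
  simpa using this

/-- Inserting at a skew cut keeps the top gap open. -/
theorem hasState_ins_skew (hL : IsWord (m + 1) L) (ht : Open ε L (m + 1)) {l₁ l₂ : List ℕ}
    (h : gaps ε L = l₁ ++ v :: l₂) (hv : SkewCut L v) (hl : ∀ u ∈ gaps ε L, ¬SumCut L u) :
    HasState ε (ins L v) (.X 0 (l₁.length + 1) 0) := by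
  have hv' := hL.mem_gaps.1 (show v ∈ gaps ε L by simp [h])
  have hL' := hL.ins (show v ≤ m + 1 by omega)
  have hp := pairwise_gaps (ε := ε) (L := L)
  rw [h] at hp
  have := HasState.x (ε := ε) (L := ins L v) (lq := []) (lo := l₁ ++ [v]) (ls := [])
    (by
      rw [gaps_ins_of_not hL h (hl v (by simp [h]))
        (fun _ g hg _ hn => hl g hg hn.1)]
      simp)
    (by rw [hL'.length, hL.open_ins_top (by omega)]; exact ⟨ht, hv⟩)
    (by simp)
    (fun u hu => by
      have huv : u ≤ v := by
        rcases mem_append.1 hu with hu | hu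
        · exact (lt_of_pairwise hp hu mem_cons_self).le
        · simp at hu; omega
      have hu' : u ∈ gaps ε L := by
        rcases mem_append.1 hu with hu | hu
        · simp [h, hu]
        · simp [h, mem_singleton.1 hu]
      rw [sumCut_ins huv]
      exact ⟨hl u hu', hL.not_skewCut_ins (by omega) (hL.mem_gaps.1 hu').1.1 huv, by simp⟩)
    (by simp)
  simpa using this

/-- Inserting at a nested cut. If 31524 is allowed, its sum cut stays open; this is the extra gap
counted by `ε.toNat`. -/
theorem hasState_ins_nested (hL : IsWord (m + 1) L) {l₁ l₂ : List ℕ} {g : ℕ}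
    (h : gaps ε L = l₁ ++ v :: l₂) (hg : g ∈ gaps ε L) (hvg : v < g) (hn : NestedCut L v g)
    (hl : ∀ u ∈ l₁, ¬SumCut L u) :
    HasState ε (ins L v) (.W (l₁.length + 1 + ε.toNat)) := by
  have hv' := hL.mem_gaps.1 (show v ∈ gaps ε L by simp [h])
  have hg' := hL.mem_gaps.1 hg
  have hv := hL.not_sumCut_of_nestedCut (by omega) hvg (by omega) hn
  have hk := hL.not_skewCut_of_nestedCut (by omega) hvg (by omega) hn
  cases ε
  · simpa using hasState_ins_w hL h (gaps_ins_of_not hL h hv (by simp)) hl hv (by tauto)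
  · simpa [add_assoc] using
      hasState_ins_w hL h (gaps_ins_of_nestedCut hL h hg hvg hn) hl hv (by tauto)

/-- Inserting at any other gap only leaves the gaps up to that one. -/
theorem hasState_ins_other (hL : IsWord (m + 1) L) {l₁ l₂ : List ℕ}
    (h : gaps ε L = l₁ ++ v :: l₂) (hl : ∀ u ∈ l₁, ¬SumCut L u) (hv : ¬SumCut L v)
    (hn : ∀ g ∈ gaps ε L, SumCut L g → ¬NestedCut L v g)
    (ht : ¬(Open ε L (m + 1) ∧ SkewCut L v)) :
    HasState ε (ins L v) (.W (l₁.length + 1)) := by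
  simpa using hasState_ins_w hL h (gaps_ins_of_not hL h hv fun _ g hg _ hn' =>
    hn g hg hn'.1 hn') hl hv ht

theorem not_sumCut_of_exists_nestedCut (hL : IsWord (m + 1) L) {lq lo ls lx : List ℕ}
    (hg : gaps ε L = lq ++ lo ++ ls ++ lx) (hq : ∀ u ∈ lq, ∃ g ∈ ls, NestedCut L u g) {u : ℕ}
    (hu : u ∈ lq) : ∃ g ∈ gaps ε L, u < g ∧ NestedCut L u g ∧ ¬SumCut L u := by
  obtain ⟨g, hgs, hn⟩ := hq u hu
  have hp := pairwise_gaps (ε := ε) (L := L)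
  rw [hg, append_assoc, append_assoc] at hp
  have hug : u < g := lt_of_pairwise hp hu (by simp [hgs])
  have hu' := hL.mem_gaps.1 (show u ∈ gaps ε L by simp [hg, hu])
  exact ⟨g, by simp [hg, hgs], hug, hn, hL.not_sumCut_of_nestedCut (by omega) hug (by omega) hn⟩

/-- The children made by the gaps below the first sum cut, when nested cuts come first. -/
theorem sum_extCount_below {k : ℕ} (ih : ∀ {m : ℕ} {L : List ℕ} {s : State},
      IsWord (m + 1) L → HasState ε L s → extCount ε k L = s.count ε k)
    (hL : IsWord (m + 1) L) {lq lo ls lx : List ℕ}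
    (hg : gaps ε L = lq ++ lo ++ ls ++ lx) (hq : ∀ u ∈ lq, ∃ g ∈ ls, NestedCut L u g)
    (ho : ∀ u ∈ lo, ¬SumCut L u ∧ ∀ g ∈ ls, ¬NestedCut L u g)
    (ht : ∀ u ∈ lo, ¬(Open ε L (m + 1) ∧ SkewCut L u)) (hx : ∀ u ∈ lx, ¬SumCut L u) :
    ((lq ++ lo).map fun v => extCount ε k (ins L v)).sum =
      ((List.range lq.length).map fun i => (State.W (i + 1 + ε.toNat)).count ε k).sum +
      ((List.range lo.length).map fun i => (State.W (lq.length + i + 1)).count ε k).sum := by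
  have hq' := fun {u} => not_sumCut_of_exists_nestedCut (u := u) hL hg hq
  have hi : ∀ {v : ℕ}, v ∈ gaps ε L → IsWord (m + 1 + 1) (ins L v) := fun hv =>
    hL.ins (by have := hL.mem_gaps.1 hv; omega)
  rw [map_append, sum_append]
  congr 1
  · refine sum_map_eq_sum_range fun l₁ v l₂ h => ?_
    obtain ⟨g, hgm, hvg, hn, -⟩ := hq' (show v ∈ lq by simp [h])
    have h' : gaps ε L = l₁ ++ v :: (l₂ ++ lo ++ ls ++ lx) := by simp [hg, h]
    exact ih (hi (by simp [h'])) (hasState_ins_nested hL h' hgm hvg hn fun u hu =>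
      (hq' (show u ∈ lq by simp [h, hu])).choose_spec.2.2.2)
  · refine sum_map_eq_sum_range fun l₁ v l₂ h => ?_
    have h' : gaps ε L = (lq ++ l₁) ++ v :: (l₂ ++ ls ++ lx) := by simp [hg, h]
    have hv := ho v (by simp [h])
    rw [ih (hi (by simp [h'])) (hasState_ins_other hL h' (fun u hu => ?_) hv.1
      (fun g hgm hgs hn => ?_) (ht v (by simp [h]))), length_append]
    · rcases mem_append.1 hu with hu | hu
      · exact (hq' hu).choose_spec.2.2.2
      · exact (ho u (by simp [h, hu])).1
    · rw [hg] at hgm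
      simp only [mem_append] at hgm
      rcases hgm with ((hgm | hgm) | hgm) | hgm
      · exact (hq' hgm).choose_spec.2.2.2 hgs
      · exact (ho g hgm).1 hgs
      · exact hv.2 g hgm hn
      · exact hx g hgm hgs

/-- The children made by the sum cuts. -/
theorem sum_extCount_sumCut {k : ℕ} (ih : ∀ {m : ℕ} {L : List ℕ} {s : State},
      IsWord (m + 1) L → HasState ε L s → extCount ε k L = s.count ε k)
    (hL : IsWord (m + 1) L) {lq lo ls lx : List ℕ}
    (hg : gaps ε L = lq ++ lo ++ ls ++ lx) (hq : ∀ u ∈ lq, ∃ g ∈ ls, NestedCut L u g)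
    (ho : ∀ u ∈ lo, ¬SumCut L u ∧ ∀ g ∈ ls, ¬NestedCut L u g) (hs : ∀ u ∈ ls, SumCut L u) :
    (ls.map fun v => extCount ε k (ins L v)).sum =
      ((List.range ls.length).map fun j =>
        (State.Y lq.length lo.length (j + 1)).count ε k).sum := by
  refine sum_map_eq_sum_range fun l₁ v l₂ h => ?_
  have h' : gaps ε L = lq ++ lo ++ l₁ ++ v :: (l₂ ++ lx) := by simp [hg, h]
  have hv := hL.mem_gaps.1 (show v ∈ gaps ε L by simp [h'])
  refine ih (hL.ins (by omega)) (hasState_ins_sum hL h' (fun u hu => ?_)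
    (fun u hu => ⟨(ho u hu).1, fun g hgm => (ho u hu).2 g ?_⟩) (fun u hu => hs u ?_))
  · obtain ⟨g, hgm, hn⟩ := hq u hu
    refine ⟨g, ?_, hn⟩
    rw [h] at hgm
    simp only [mem_append, mem_cons] at hgm ⊢
    tauto
  · rw [h]
    simp only [mem_append, mem_cons, not_mem_nil, or_false] at hgm ⊢
    tauto
  · rw [h]
    simp only [mem_append, mem_cons, not_mem_nil, or_false] at hu ⊢
    tauto

end Transitions

/-- The words of the class grow according to the generating tree. -/
theorem extCount_eq_count {ε : Bool} (k : ℕ) : ∀ {m : ℕ} {L : List ℕ} {s : State},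
    IsWord (m + 1) L → HasState ε L s → extCount ε k L = s.count ε k := by
  induction k with
  | zero => intros; rfl
  | succ k ih =>
    intro m L s hL hs
    rw [hL.extCount_succ, State.count]
    have hi : ∀ {v : ℕ}, v ∈ gaps ε L → IsWord (m + 1 + 1) (ins L v) := fun hv =>
      hL.ins (by have := hL.mem_gaps.1 hv; omega)
    have h0 := hL.ins (Nat.zero_le (m + 1))
    have hp := pairwise_gaps (ε := ε) (L := L)
    cases hs with
    | @w l hg htop hl =>
      rw [hL.length] at htop
      subst hg
      rw [if_neg htop, ih h0 (hasState_ins_zero_w hL htop),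
        sum_map_eq_sum_range (g := fun i => (State.W (i + 1)).count ε k)]
      · simp [State.children, Function.comp_def]
      · intro l₁ v l₂ h
        have hv := hl v (by simp [h])
        have := hasState_ins_w hL h
          (gaps_ins_of_not hL h hv fun _ g hg _ hn => hl g hg hn.1)
          (fun u hu => hl u (by simp [h, hu])) hv (by tauto)
        simpa using ih (hi (by simp [h])) this
    | @y lq lo ls x hg htop hq ho hs hx =>
      rw [hL.length] at htop
      have hxm := hL.mem_gaps.1 (show x ∈ gaps ε L by simp [hg])
      have hle : ∀ u ∈ lq ++ lo ++ ls, u ≤ x := fun u hu =>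
        (lt_of_pairwise (hg ▸ hp) hu (mem_singleton.2 rfl)).le
      -- Inserting at the gap above all sum cuts reproduces the label.
      have hY : HasState ε (ins L x) (.Y lq.length lo.length ls.length) := by
        refine .y (x := x) ?_ ?_ (fun u hu => ?_) (fun u hu => ?_) (fun u hu => ?_) ?_
        · refine gaps_ins_of_not hL hg hx fun _ g hgm hxg _ => ?_
          rw [hg, mem_append, mem_singleton] at hgm
          rcases hgm with hgm | rfl
          · have := hle g hgm; omega
          · omega
        · rw [(hL.ins (show x ≤ m + 1 by omega)).length, hL.open_ins_top (by omega)]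
          tauto
        · obtain ⟨g, hgm, hn⟩ := hq u hu
          exact ⟨g, hgm, (nestedCut_ins (hle u (by simp [hu])) (hle g (by simp [hgm]))).2 hn⟩
        · rw [sumCut_ins (hle u (by simp [hu]))]
          refine ⟨(ho u hu).1, fun g hgm => ?_⟩
          rw [nestedCut_ins (hle u (by simp [hu])) (hle g (by simp [hgm]))]
          exact (ho u hu).2 g hgm
        · rw [sumCut_ins (hle u (by simp [hu]))]; exact hs u hu
        · rwa [sumCut_ins le_rfl]
      rw [if_neg htop, ih h0 (hasState_ins_zero_w hL htop), hg, map_append, map_append,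
        sum_append, sum_append, sum_extCount_below ih hL hg hq ho (fun _ _ => by tauto)
          (by simpa using hx), sum_extCount_sumCut ih hL hg hq ho hs, map_singleton,
        sum_singleton, ih (hi (by simp [hg])) hY]
      simp [State.children, Function.comp_def, add_assoc]
    | @x lq lo ls hg htop hq ho hs =>
      rw [hL.length] at htop
      have hg' : gaps ε L = lq ++ lo ++ ls ++ [] := by simp [hg]
      have ho' : ∀ u ∈ lo, ¬SumCut L u ∧ ∀ g ∈ ls, ¬NestedCut L u g := fun u hu =>
        ⟨(ho u hu).1, (ho u hu).2.2⟩
      have hV := hasState_ins_zero_v (lk := []) (lo := gaps ε L) hL htop rfl (by simp) fun u hu => by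
        have hum := hL.mem_gaps.1 hu
        rw [hg, mem_append, mem_append] at hu
        rcases hu with (hu | hu) | hu
        · obtain ⟨g, hgm, hug, hn, -⟩ := not_sumCut_of_exists_nestedCut hL hg' hq hu
          exact hL.not_skewCut_of_nestedCut hum.1.1 hug (hL.mem_gaps.1 hgm).1.2 hn
        · exact (ho u hu).2.1
        · exact hL.not_skewCut_of_sumCut hum.1.1 hum.1.2 (hs u hu)
      have hX := hasState_ins_top hL htop hg
        (fun u hu => (hq u hu).imp fun g hgm => ⟨by simp [hgm.1], hgm.2⟩) ho hs
      rw [if_pos htop, ih h0 hV, ih (hL.ins le_rfl) hX, hg, map_append, sum_append,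
        sum_extCount_below ih hL hg' hq ho' (fun u hu => by have := ho u hu; tauto) (by simp),
        sum_extCount_sumCut ih hL hg' hq ho' hs]
      simp [State.children, Function.comp_def, add_assoc]
    | @v lk lo hg htop hk ho =>
      rw [hL.length] at htop
      have hg' : gaps ε L = lk ++ lo ++ [] := by simp [hg]
      have hsum : ∀ u ∈ gaps ε L, ¬SumCut L u := fun u hu hu' => by
        have hum := hL.mem_gaps.1 hu
        rw [hg, mem_append] at hu
        rcases hu with hu | hu
        · exact hL.not_skewCut_of_sumCut hum.1.1 hum.1.2 hu' (hk u hu)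
        · exact (ho u hu).1 hu'
      have hV := hasState_ins_zero_v hL htop hg hk fun u hu => (ho u hu).2
      have hX := hasState_ins_top hL htop hg'
        (fun u hu => ⟨m + 1, by simp, hL.nestedCut_top.2 (hk u hu)⟩)
        (fun u hu => ⟨(ho u hu).1, (ho u hu).2, by simp⟩) (by simp)
      rw [if_pos htop, ih h0 hV, ih (hL.ins le_rfl) hX, hg, map_append, sum_append,
        sum_map_eq_sum_range (l := lk) (g := fun i => (State.X 0 (i + 1) 0).count ε k),
        sum_map_eq_sum_range (l := lo) (g := fun i => (State.W (lk.length + i + 1)).count ε k)]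
      · simp [State.children, Function.comp_def, add_assoc]
      · rintro l₁ v l₂ rfl
        have h : gaps ε L = (lk ++ l₁) ++ v :: l₂ := by simp [hg]
        rw [ih (hi (by simp [h])) (hasState_ins_other hL h (fun u hu => hsum u ?_)
          (hsum v (by simp [h])) (fun g hgm hgs => absurd hgs (hsum g hgm))
          fun hh => (ho v (by simp)).2 hh.2), length_append]
        simp only [h, mem_append] at hu ⊢
        exact .inl hu
      · rintro l₁ v l₂ rfl
        have h : gaps ε L = l₁ ++ v :: (l₂ ++ lo) := by simp [hg]
        exact ih (hi (by simp [h])) (hasState_ins_skew hL htop h (hk v (by simp)) hsum)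

/-! ### From words to permutations -/

section Words

open Classical in
/-- All words of length `n` in the class, generated by appending letters. -/
noncomputable def words (ε : Bool) : ℕ → List (List ℕ)
  | 0 => [[]]
  | n + 1 => (words ε n).flatMap fun L =>
      ((List.range (L.length + 1)).filter (fun u => Open ε L u)).map (ins L)

theorem sum_map_flatMap {α β : Type*} (l : List α) (f : α → List β) (g : β → ℕ) :
    ((l.flatMap f).map g).sum = (l.map fun a => ((f a).map g).sum).sum := by
  induction l with
  | nil => rfl
  | cons a l ih => simp [ih]

theorem sum_extCount_words (ε : Bool) (k n : ℕ) :
    ((words ε n).map (extCount ε k)).sum = (words ε (n + k)).length := by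
  induction k generalizing n with
  | zero => simp [extCount]
  | succ k ih =>
    rw [show n + (k + 1) = n + 1 + k by omega, ← ih, words, sum_map_flatMap]
    simp only [map_map, Function.comp_def, extCount]

theorem IsWord.exists_eq_ins {n : ℕ} {L : List ℕ} (hL : IsWord (n + 1) L) :
    ∃ L₀ v, IsWord n L₀ ∧ v ≤ n ∧ L = _root_.ins L₀ v := by
  obtain ⟨l, v, rfl⟩ : ∃ l v, L = l ++ [v] := by
    rcases eq_nil_or_concat L with rfl | ⟨l, v, rfl⟩
    · simpa using hL.length
    · exact ⟨l, v, by simp⟩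
  have hnd := hL.nodup
  rw [nodup_append] at hnd
  have hne : ∀ a ∈ l, a ≠ v := fun a ha => hnd.2.2 a ha v (by simp)
  have hlt : ∀ a ∈ l, a < n + 1 := fun a ha => hL.mem.1 (by simp [ha])
  have hv : v < n + 1 := hL.mem.1 (by simp)
  -- Removing the last letter `v` and closing the gap it leaves is inverse to `ins`.
  have hmap : (l.map fun a => if v < a then a - 1 else a).map (shiftUp v) = l := by
    rw [map_map]
    refine (map_congr_left fun a ha => ?_).trans (map_id l)
    have := hne a ha
    simp only [Function.comp, shiftUp, id]
    split_ifs <;> omega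
  refine ⟨l.map fun a => if v < a then a - 1 else a, v, isWord_of_nodup ?_ ?_ ?_, by omega, ?_⟩
  · simpa using hL.length
  · exact Nodup.of_map (shiftUp v) (by rw [hmap]; exact hnd.1)
  · intro x hx
    obtain ⟨a, ha, rfl⟩ := mem_map.1 hx
    have := hne a ha
    have := hlt a ha
    split_ifs <;> omega
  · rw [_root_.ins, hmap]

theorem avoids_nil (ε : Bool) : Avoids ε [] := by
  simp [Avoids]

theorem mem_words {ε : Bool} {n : ℕ} {L : List ℕ} :
    L ∈ words ε n ↔ IsWord n L ∧ Avoids ε L := by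
  induction n generalizing L with
  | zero =>
    simp only [words, mem_singleton, IsWord, range_zero, perm_nil]
    exact ⟨fun h => ⟨h, h ▸ avoids_nil ε⟩, fun h => h.1⟩
  | succ n ih =>
    simp only [words, mem_flatMap, mem_map, mem_filter, mem_range, decide_eq_true_eq]
    constructor
    · rintro ⟨L₀, h₀, v, ⟨hv, ho⟩, rfl⟩
      obtain ⟨hw, ha⟩ := ih.1 h₀
      rw [hw.length] at hv
      exact ⟨hw.ins (by omega), avoids_ins.2 ⟨ha, ho⟩⟩
    · rintro ⟨hw, ha⟩
      obtain ⟨L₀, v, h₀, hv, rfl⟩ := hw.exists_eq_ins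
      rw [avoids_ins] at ha
      exact ⟨L₀, ih.2 ⟨h₀, ha.1⟩, v, ⟨by rw [h₀.length]; omega, ha.2⟩, rfl⟩

theorem ins_inj {L L' : List ℕ} {v v' : ℕ} (h : ins L v = ins L' v') : L = L' ∧ v = v' := by
  obtain ⟨h1, h2⟩ := append_inj' h rfl
  obtain rfl : v = v' := by simpa using h2
  exact ⟨map_injective_iff.2 (shiftUp_injective v) h1, rfl⟩

theorem nodup_words (ε : Bool) (n : ℕ) : (words ε n).Nodup := by
  induction n with
  | zero => simp [words]
  | succ n ih =>
    rw [words, nodup_flatMap]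
    refine ⟨fun L _ => ((nodup_range).filter _).map fun a b h => (ins_inj h).2, ?_⟩
    refine ih.imp fun {L L'} hne => ?_
    simp only [Function.onFun, disjoint_left, mem_map]
    rintro _ ⟨v, _, rfl⟩ ⟨v', _, h⟩
    exact hne (ins_inj h).1.symm

/-- The one-line notation of a permutation. -/
def oneLine {n : ℕ} (σ : Equiv.Perm (Fin n)) : List ℕ := List.ofFn fun i => (σ i : ℕ)

theorem isWord_oneLine {n : ℕ} (σ : Equiv.Perm (Fin n)) : IsWord n (oneLine σ) := by
  refine isWord_of_nodup (by simp [oneLine]) ?_ ?_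
  · exact nodup_ofFn.2 fun i j h => σ.injective (Fin.ext h)
  · simp only [oneLine, mem_ofFn]
    rintro _ ⟨i, rfl⟩
    exact (σ i).2

theorem oneLine_injective {n : ℕ} : Function.Injective (oneLine (n := n)) := fun σ τ h => by
  refine Equiv.ext fun i => Fin.ext ?_
  exact congrFun (ofFn_injective h) i

theorem IsWord.exists_oneLine {n : ℕ} {L : List ℕ} (hL : IsWord n L) :
    ∃ σ : Equiv.Perm (Fin n), oneLine σ = L := by
  let f : Fin n → Fin n := fun i =>
    ⟨L.get (i.cast hL.length.symm), hL.mem.1 (get_mem _ _)⟩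
  have hf : Function.Injective f := fun i j h => by
    have := (nodup_iff_injective_get.1 hL.nodup) (Fin.val_eq_of_eq h)
    simpa using this
  refine ⟨Equiv.ofBijective f (Finite.injective_iff_bijective.1 hf), ?_⟩
  refine ext_get (by simp [oneLine, hL.length]) fun i h1 h2 => ?_
  simp [oneLine, f]

theorem contains_iff {n k : ℕ} {σ : Equiv.Perm (Fin n)} {π : Equiv.Perm (Fin k)} :
    FinPerm.Contains ⟨n, σ⟩ ⟨k, π⟩ ↔
      ∃ t : Fin k → ℕ, List.ofFn t <+ oneLine σ ∧ ∀ i j, π i < π j ↔ t i < t j := by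
  constructor
  · rintro ⟨f, hf⟩
    refine ⟨fun i => σ (f i), ?_, fun i j => hf i j⟩
    rw [sublist_iff_exists_fin_orderEmbedding_get_eq]
    refine ⟨((Fin.castOrderIso (by simp)).toOrderEmbedding.trans f).trans
      (Fin.castOrderIso (by simp [oneLine])).toOrderEmbedding, fun i => ?_⟩
    simp [oneLine]
    rfl
  · rintro ⟨t, ht, h⟩
    rw [sublist_iff_exists_fin_orderEmbedding_get_eq] at ht
    obtain ⟨f, hf⟩ := ht
    refine ⟨((Fin.castOrderIso (by simp)).toOrderEmbedding.trans f).trans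
      (Fin.castOrderIso (by simp [oneLine])).toOrderEmbedding, fun i j => ?_⟩
    have key : ∀ i : Fin k, t i = σ ((f (i.cast (by simp))).cast (by simp [oneLine])) := by
      intro i
      have := hf (i.cast (by simp))
      simp only [get_eq_getElem, List.getElem_ofFn, oneLine] at this
      exact this
    simp only [h i j, key i, key j]
    rfl

theorem contains_four_iff {n : ℕ} {σ : Equiv.Perm (Fin n)} {π : Equiv.Perm (Fin 4)} :
    FinPerm.Contains ⟨n, σ⟩ ⟨4, π⟩ ↔ ∃ a b c d, [a, b, c, d] <+ oneLine σ ∧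
      ∀ i j, π i < π j ↔ ![a, b, c, d] i < ![a, b, c, d] j := by
  rw [contains_iff]
  constructor
  · rintro ⟨t, ht, h⟩
    refine ⟨t 0, t 1, t 2, t 3, by simpa [ofFn_succ] using ht, ?_⟩
    have : ![t 0, t 1, t 2, t 3] = t := by ext i; fin_cases i <;> rfl
    rwa [this]
  · rintro ⟨a, b, c, d, ht, h⟩
    exact ⟨_, by simpa [ofFn_succ] using ht, h⟩

theorem contains_five_iff {n : ℕ} {σ : Equiv.Perm (Fin n)} {π : Equiv.Perm (Fin 5)} :
    FinPerm.Contains ⟨n, σ⟩ ⟨5, π⟩ ↔ ∃ a b c d e, [a, b, c, d, e] <+ oneLine σ ∧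
      ∀ i j, π i < π j ↔ ![a, b, c, d, e] i < ![a, b, c, d, e] j := by
  rw [contains_iff]
  constructor
  · rintro ⟨t, ht, h⟩
    refine ⟨t 0, t 1, t 2, t 3, t 4, by simpa [ofFn_succ] using ht, ?_⟩
    have : ![t 0, t 1, t 2, t 3, t 4] = t := by ext i; fin_cases i <;> rfl
    rwa [this]
  · rintro ⟨a, b, c, d, e, ht, h⟩
    exact ⟨_, by simpa [ofFn_succ] using ht, h⟩

theorem contains_p4123_iff {n : ℕ} {σ : Equiv.Perm (Fin n)} :
    FinPerm.Contains ⟨n, σ⟩ p4123 ↔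
      ∃ a b c d, [a, b, c, d] <+ oneLine σ ∧ b < c ∧ c < d ∧ d < a := by
  rw [p4123, contains_four_iff]
  refine exists₄_congr fun a b c d => and_congr_right fun _ => ?_
  simp [Fin.forall_fin_succ]
  omega

theorem contains_p1324_iff {n : ℕ} {σ : Equiv.Perm (Fin n)} :
    FinPerm.Contains ⟨n, σ⟩ p1324 ↔
      ∃ a b c d, [a, b, c, d] <+ oneLine σ ∧ a < c ∧ c < b ∧ b < d := by
  rw [p1324, contains_four_iff]
  refine exists₄_congr fun a b c d => and_congr_right fun _ => ?_
  simp [Fin.forall_fin_succ]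
  omega

theorem contains_p31524_iff {n : ℕ} {σ : Equiv.Perm (Fin n)} :
    FinPerm.Contains ⟨n, σ⟩ p31524 ↔
      ∃ a b c d e, [a, b, c, d, e] <+ oneLine σ ∧ b < d ∧ d < a ∧ a < e ∧ e < c := by
  rw [p31524, contains_five_iff]
  refine exists₅_congr fun a b c d e => and_congr_right fun _ => ?_
  simp [Fin.forall_fin_succ]
  omega

/-- The two bases in play: 31524 belongs to the basis exactly if `ε = false`. -/
def basis (ε : Bool) : Set FinPerm :=
  if ε then {p4123, p1324} else {p4123, p1324, p31524}

theorem mem_av_basis_iff {ε : Bool} {n : ℕ} {σ : Equiv.Perm (Fin n)} :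
    (⟨n, σ⟩ : FinPerm) ∈ Av (basis ε) ↔ Avoids ε (oneLine σ) := by
  have h1 := contains_p4123_iff (σ := σ)
  have h2 := contains_p1324_iff (σ := σ)
  have h3 := contains_p31524_iff (σ := σ)
  cases ε <;>
  simp only [Av, basis, Set.mem_ofPred_eq, Set.mem_insert_iff, Set.mem_singleton_iff,
    forall_eq_or_imp, forall_eq, h1, h2, h3, Avoids, if_true, if_false, Bool.false_eq_true] <;>
  grind

theorem permCount_eq_length_words (ε : Bool) (n : ℕ) :
    permCount (Av (basis ε)) n = (words ε n).length := by
  classical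
  have hf : Function.Bijective (fun σ : {σ : Equiv.Perm (Fin n) // (⟨n, σ⟩ : FinPerm) ∈
      Av (basis ε)} => (⟨oneLine σ.1, mem_words.2 ⟨isWord_oneLine _, mem_av_basis_iff.1 σ.2⟩⟩ :
      {L : List ℕ // L ∈ words ε n})) := by
    refine ⟨fun σ τ h => Subtype.ext (oneLine_injective (congrArg Subtype.val h)), ?_⟩
    rintro ⟨L, hL⟩
    obtain ⟨hw, ha⟩ := mem_words.1 hL
    obtain ⟨σ, rfl⟩ := hw.exists_oneLine
    exact ⟨⟨σ, mem_av_basis_iff.2 ha⟩, rfl⟩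
  rw [permCount, Nat.card_congr (Equiv.ofBijective _ hf),
    Nat.subtype_card (words ε n).toFinset (fun _ => mem_toFinset),
    toFinset_card_of_nodup (nodup_words ε n)]

theorem permCount_zero (ε : Bool) : permCount (Av (basis ε)) 0 = 1 := by
  rw [permCount_eq_length_words]; rfl

/-- The counting sequence of the class is the level sequence of the generating tree. -/
theorem permCount_succ (ε : Bool) (k : ℕ) :
    permCount (Av (basis ε)) (k + 1) = (State.X 0 0 0).count ε k := by
  classical
  have h1 : words ε 1 = [[0]] := by
    simp [words, open_zero, ins, range_succ]
  have hL : IsWord (0 + 1) [0] := Perm.refl _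
  have ho : Open ε [0] [0].length := by
    refine ⟨fun a b c h => ?_, fun _ a b c d h => ?_⟩ <;> simpa using h.length_le
  have hs : HasState ε [0] (.X 0 0 0) :=
    .x (lq := []) (lo := []) (ls := []) rfl ho (by simp) (by simp) (by simp)
  rw [permCount_eq_length_words, add_comm, ← sum_extCount_words, h1, map_singleton, sum_singleton,
    extCount_eq_count k hL hs]

end Words

/-! ### The strict inclusions -/

section Inclusions

theorem FinPerm.Contains.trans {ρ σ τ : FinPerm} (h : ρ.Contains σ) (h' : σ.Contains τ) :
    ρ.Contains τ := by
  obtain ⟨f, hf⟩ := h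
  obtain ⟨g, hg⟩ := h'
  exact ⟨g.trans f, fun i j => (hg i j).trans (hf _ _)⟩

theorem FinPerm.Contains.refl (σ : FinPerm) : σ.Contains σ :=
  ⟨RelEmbedding.refl _, fun _ _ => Iff.rfl⟩

theorem p31524_contains_p3124 : p31524.Contains p3124 :=
  ⟨OrderEmbedding.ofStrictMono (β := Fin 5) ![0, 1, 3, 4] (fun i j => by decide +revert), by decide⟩

theorem p31524_contains_p1423 : p31524.Contains p1423 :=
  ⟨OrderEmbedding.ofStrictMono (β := Fin 5) ![1, 2, 3, 4] (fun i j => by decide +revert), by decide⟩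

theorem av_ssubset_av_of_contains {π : FinPerm} (h : p31524.Contains π)
    (h4 : ¬π.Contains p4123) (h1 : ¬π.Contains p1324) (h3 : ¬π.Contains p31524) :
    Av {p4123, p1324, π} ⊂ Av {p4123, p1324, p31524} := by
  rw [Set.ssubset_iff_of_subset]
  · refine ⟨π, ?_, fun hπ => hπ π (by simp) (.refl π)⟩
    rintro ρ (rfl | rfl | rfl) <;> assumption
  · rintro σ hσ ρ (rfl | rfl | rfl) hc
    · exact hσ _ (by simp) hc
    · exact hσ _ (by simp) hc
    · exact hσ π (by simp) (hc.trans h)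

theorem FinPerm.not_contains_of_lt {σ π : FinPerm} (h : σ.1 < π.1) : ¬σ.Contains π := by
  rintro ⟨f, -⟩
  have := Fintype.card_le_of_injective f f.injective
  simp at this
  omega

theorem FinPerm.Contains.eq_of_length {n : ℕ} {σ π : Equiv.Perm (Fin n)}
    (h : FinPerm.Contains ⟨n, σ⟩ ⟨n, π⟩) : ∀ i j, π i < π j ↔ σ i < σ j := by
  obtain ⟨f, hf⟩ := h
  have hr : Set.range f = Set.range (id : Fin n → Fin n) := by
    rw [Set.range_id, (Finite.injective_iff_surjective.1 f.injective).range_eq]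
  have hid : ⇑f = id := StrictMono.range_inj f.strictMono strictMono_id |>.1 hr
  simpa [hid] using hf

theorem av_p3124_ssubset : Av {p4123, p1324, p3124} ⊂ Av {p4123, p1324, p31524} :=
  av_ssubset_av_of_contains p31524_contains_p3124
    (fun h => absurd (h.eq_of_length) (by decide))
    (fun h => absurd (h.eq_of_length) (by decide))
    (FinPerm.not_contains_of_lt (by decide))

theorem av_p1423_ssubset : Av {p4123, p1324, p1423} ⊂ Av {p4123, p1324, p31524} :=
  av_ssubset_av_of_contains p31524_contains_p1423
    (fun h => absurd (h.eq_of_length) (by decide))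
    (fun h => absurd (h.eq_of_length) (by decide))
    (FinPerm.not_contains_of_lt (by decide))

theorem p31524_not_contains_of {π : Equiv.Perm (Fin 4)}
    (h : ∀ a b c d : Fin 5, a < b → b < c → c < d →
      ¬∀ i j, π i < π j ↔ p31524.2 (![a, b, c, d] i) < p31524.2 (![a, b, c, d] j)) :
    ¬p31524.Contains ⟨4, π⟩ := by
  rintro ⟨f : Fin 4 ↪o Fin 5, hf⟩
  have h01 : f 0 < f 1 := f.strictMono (by decide)
  have h12 : f 1 < f 2 := f.strictMono (by decide)
  have h23 : f 2 < f 3 := f.strictMono (by decide)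
  refine h (f 0) (f 1) (f 2) (f 3) h01 h12 h23 fun i j => ?_
  have : ![f 0, f 1, f 2, f 3] = f := by
    ext i; fin_cases i <;> rfl
  rw [this]
  exact hf i j

theorem av_p31524_ssubset : Av {p4123, p1324, p31524} ⊂ Av {p4123, p1324} := by
  have hsub : Av {p4123, p1324, p31524} ⊆ Av {p4123, p1324} := fun σ hσ ρ hρ => by
    rcases hρ with rfl | rfl <;> exact hσ _ (by simp)
  rw [Set.ssubset_iff_of_subset hsub]
  refine ⟨p31524, ?_, fun h => h p31524 (by simp) (.refl _)⟩
  rintro ρ (rfl | rfl)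
  · exact p31524_not_contains_of (by decide)
  · exact p31524_not_contains_of (by decide)

end Inclusions

end Combinatorics

/-! ### Solution of the functional equations -/

/-- The quantities in terms of which the generating functions of the tree are expressed: the
variable `z`, a root `C` of `C = 1 + z C²`, and inverses of `1 - z`, `1 - 2z`, `1 - 3z + z²` and
`1 - 2zC`. -/
structure Params (A : Type*) [CommRing A] where
  z : A
  C : A
  i₁ : A
  i₂ : A
  iD : A
  iR : A
  hC : C = 1 + z * C ^ 2
  h₁ : (1 - z) * i₁ = 1
  h₂ : (1 - 2 * z) * i₂ = 1
  hD : (1 - 3 * z + z ^ 2) * iD = 1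
  hR : (1 - 2 * z * C) * iR = 1

namespace Params
variable {A B : Type*} [CommRing A] [CommRing B] (P : Params A)

/-- `r = (1 - z) / (1 - 2z)`, the ratio of the geometric terms produced by the sum cuts. -/
def r : A := (1 - P.z) * P.i₂

/-- The coefficient of `C ^ (a + b) * r ^ c` in the series of the label `X a b c`. -/
def p : A := -((1 - P.z) * (1 - 2 * P.z) * P.iD)

/-- The coefficient of `C ^ (a + b + c)` in the series of the label `X a b c`. -/
def lam : A :=
  (P.z ^ 2 * (1 + P.p * P.r) * P.C + (1 - P.z) - P.z ^ 2 * P.C ^ 2) * P.iR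

/-- The constant term, independent of `a`, `b`, `c`, in the series of the label `X a b c`. -/
def kap : A :=
  P.z ^ 2 * (1 - P.z) ^ 2 * P.iD * (P.i₁ + (P.p + P.lam) * P.C ^ 2 * P.i₁ - P.C ^ 2)

/-- The gain, from the extra open gap next to each of `a` nested cuts, when 31524 is allowed. -/
def del (a : ℕ) : A := P.z * (P.C ^ (a + 2) - P.C ^ 2)

/-- The part of the gain from allowing 31524 that does not depend on the label. -/
def U : A := P.z ^ 3 * (1 - P.z) ^ 2 * P.C ^ 2 * ((1 - P.z) * P.C ^ 2 - 1) * P.iD ^ 2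

/-- The geometric sum `C + C² + ⋯ + C ^ a`. -/
def S (a : ℕ) : A := ∑ i ∈ Finset.range a, P.C ^ (i + 1)

/-- The generating function, by level, of the subtree below a node with the given label, times `z`.
The factor `z` cancels the denominators `z` that the labels `X` and `Y` would have. -/
def gf (ε : Bool) : State → A
  | .W m => P.z * P.C ^ (m + 1)
  | .Y a b c => P.C ^ (a + b + c + 1) - P.C ^ (a + b) * P.r ^ c +
      (if ε then P.z * P.r ^ c * P.del a * P.i₁ else 0)
  | .X a b c => P.p * P.C ^ (a + b) * P.r ^ c + P.kap + P.lam * P.C ^ (a + b + c) +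
      (if ε then P.z * (P.del a * P.r ^ c * (1 - 2 * P.z) * P.iD + P.U) else 0)
  | .V a b => P.z * ((1 + (a + 1) * P.kap) * P.i₁ + P.kap * P.z * P.i₁ ^ 2 +
      (P.p + P.lam) * (P.S a + P.C ^ (a + 1) - P.C ^ a) * P.i₁ - P.C ^ (a + 1) +
      P.C ^ (a + b + 1) * (1 + P.p * P.r + P.lam * P.C) +
      (if ε then P.z * (P.U * (a + 1) * P.i₁ + P.U * P.z * P.i₁ ^ 2 +
        (1 - P.z) * P.iD * P.z * (P.C ^ (a + 3) - P.C ^ 2 * P.i₁)) else 0))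

/-- Transport along a ring homomorphism. -/
def map (f : A →+* B) : Params B where
  z := f P.z
  C := f P.C
  i₁ := f P.i₁
  i₂ := f P.i₂
  iD := f P.iD
  iR := f P.iR
  hC := by simpa using congrArg f P.hC
  h₁ := by simpa using congrArg f P.h₁
  h₂ := by simpa [map_ofNat f 2] using congrArg f P.h₂
  hD := by simpa [map_ofNat f 3] using congrArg f P.hD
  hR := by simpa [map_ofNat f 2] using congrArg f P.hR

theorem gf_map (f : A →+* B) (ε : Bool) (s : State) : (P.map f).gf ε s = f (P.gf ε s) := by
  cases ε <;> cases s <;> simp [gf, map, r, p, lam, kap, del, U, S, map_ofNat f 2]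

theorem sum_W (n : ℕ) (x : A) :
    ((List.range n).map fun i => P.z * (x * P.C ^ (i + 2))).sum = x * (P.C ^ n - 1) := by
  induction n with
  | zero => simp
  | succ n ih =>
    rw [List.range_succ, List.map_append, List.sum_append, ih]
    simp only [List.map_cons, List.map_nil, List.sum_cons, List.sum_nil]
    linear_combination (-x * P.C ^ n) * P.hC

theorem sum_r (n : ℕ) :
    P.z * ((List.range n).map fun i => P.r ^ (i + 1)).sum = (1 - P.z) * (P.r ^ n - 1) := by
  have hr : P.z * P.r = (1 - P.z) * (P.r - 1) := by
    unfold r; linear_combination -(1 - P.z) * P.h₂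
  induction n with
  | zero => simp
  | succ n ih =>
    rw [List.range_succ, List.map_append, List.sum_append, mul_add, ih]
    simp only [List.map_cons, List.map_nil, List.sum_cons, List.sum_nil]
    linear_combination P.r ^ n * hr

theorem sum_S (n : ℕ) (x y : A) :
    ((List.range n).map fun i => x * P.C ^ (i + 1) + y).sum = x * P.S n + n * y := by
  induction n with
  | zero => simp [S]
  | succ n ih =>
    rw [List.range_succ, List.map_append, List.sum_append, ih, S, S, Finset.sum_range_succ]
    simp only [List.map_cons, List.map_nil, List.sum_cons, List.sum_nil]
    push_cast
    ring

/-- Both geometric sums telescope after multiplication by `z`. -/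
theorem sum_Y (ε : Bool) (a b c : ℕ) :
    P.z * ((List.range c).map fun j => P.gf ε (.Y a b (j + 1))).sum =
      P.C ^ (a + b) * ((P.C ^ c - 1) - (1 - P.z) * (P.r ^ c - 1)) +
        (if ε then P.z * P.del a * (P.r ^ c - 1) else 0) := by
  have h : ∀ j, P.gf ε (.Y a b (j + 1)) = P.C ^ (a + b) * (P.C ^ (j + 2) - P.r ^ (j + 1)) +
      (if ε then P.z * P.del a * P.i₁ else 0) * P.r ^ (j + 1) := by
    intro j
    cases ε <;> simp only [gf, if_true, if_false, Bool.false_eq_true] <;> ring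
  have hs : ∀ (l : List ℕ) (x y : A) (f g : ℕ → A),
      (l.map fun j => x * (f j - g j) + y * g j).sum =
        x * ((l.map f).sum - (l.map g).sum) + y * (l.map g).sum := by
    intro l x y f g
    induction l with
    | nil => simp
    | cons j l ih => simp only [List.map_cons, List.sum_cons, ih]; ring
  have h1 := P.sum_W c 1
  simp only [one_mul, List.sum_map_mul_left] at h1
  have h2 := P.sum_r c
  simp only [h, hs]
  cases ε <;> simp only [if_true, if_false, Bool.false_eq_true]
  · linear_combination P.C ^ (a + b) * (h1 - h2)
  · linear_combination P.C ^ (a + b) * (h1 - h2) + P.z * P.del a * P.i₁ * h2 +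
      P.z * P.del a * (P.r ^ c - 1) * P.h₁

theorem sum_gf_W (ε : Bool) (a n : ℕ) :
    ((List.range n).map fun i => P.gf ε (.W (a + i + 1))).sum = P.C ^ a * (P.C ^ n - 1) := by
  rw [← sum_W]
  congr 1
  refine List.map_congr_left fun i _ => ?_
  simp only [gf]
  ring

theorem sum_gf_W_shift (ε : Bool) (n : ℕ) :
    ((List.range n).map fun i => P.gf ε (.W (i + 1 + ε.toNat))).sum =
      P.C ^ ε.toNat * (P.C ^ n - 1) := by
  rw [← sum_gf_W (ε := ε)]
  congr 1
  refine List.map_congr_left fun i _ => ?_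
  rw [show ε.toNat + i + 1 = i + 1 + ε.toNat by omega]

theorem sum_gf_X (ε : Bool) (n : ℕ) :
    ((List.range n).map fun i => P.gf ε (.X 0 (i + 1) 0)).sum =
      (P.p + P.lam) * P.S n + n * (P.kap + if ε then P.z * P.U else 0) := by
  rw [← sum_S]
  congr 1
  refine List.map_congr_left fun i _ => ?_
  cases ε <;> simp [gf, del] <;> ring

section Field
variable {K : Type*} [Field K] (Q : Params K)

theorem C_ne_zero : Q.C ≠ 0 := fun h => by simpa [h] using Q.hC

theorem z_eq : Q.z = (Q.C - 1) / Q.C ^ 2 := by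
  have := Q.C_ne_zero
  rw [eq_div_iff (by positivity)]
  linear_combination -Q.hC

theorem gf_W_eq (ε : Bool) (m : ℕ) : Q.gf ε (.W m) =
    Q.z + Q.z * (((State.W m).children ε).map (Q.gf ε)).sum := by
  have h := Q.sum_gf_W ε 0 m
  simp only [zero_add] at h
  simp only [State.children, List.map_cons, List.map_map, Function.comp_def, List.sum_cons, h]
  simp only [gf]
  linear_combination Q.z * Q.C ^ m * Q.hC

/-- All quantities as rational functions of `C`, with the denominators as separate atoms. -/
theorem exists_rational_form : ∃ e₁ e₂ d t : K, (e₁ ≠ 0 ∧ e₂ ≠ 0 ∧ d ≠ 0 ∧ t ≠ 0) ∧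
    (e₁ = Q.C ^ 2 - Q.C + 1 ∧ e₂ = Q.C ^ 2 - 2 * Q.C + 2 ∧
      d = Q.C ^ 4 - 3 * Q.C ^ 3 + 4 * Q.C ^ 2 - 2 * Q.C + 1 ∧ t = 2 - Q.C) ∧
    (Q.i₁ = Q.C ^ 2 / e₁ ∧ Q.iD = Q.C ^ 4 / d ∧ Q.r = e₁ / e₂ ∧ Q.p = -(e₁ * e₂ / d)) ∧
    Q.lam = (Q.C ^ 4 - 4 * Q.C ^ 3 + 7 * Q.C ^ 2 - 5 * Q.C + 2) / (t * d) ∧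
    Q.kap = (Q.C - 1) ^ 4 * e₁ * (2 * Q.C ^ 4 - 6 * Q.C ^ 3 + 8 * Q.C ^ 2 - 5 * Q.C + 2) /
      (Q.C * t * d ^ 2) ∧
    Q.U = (Q.C - 1) ^ 4 * e₁ ^ 2 * Q.C / d ^ 2 := by
  have hC := Q.C_ne_zero
  obtain ⟨e₁, he₁⟩ : ∃ e, e = Q.C ^ 2 - Q.C + 1 := ⟨_, rfl⟩
  obtain ⟨e₂, he₂⟩ : ∃ e, e = Q.C ^ 2 - 2 * Q.C + 2 := ⟨_, rfl⟩
  obtain ⟨d, hd⟩ : ∃ e, e = Q.C ^ 4 - 3 * Q.C ^ 3 + 4 * Q.C ^ 2 - 2 * Q.C + 1 := ⟨_, rfl⟩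
  obtain ⟨t, ht⟩ : ∃ e, e = 2 - Q.C := ⟨_, rfl⟩
  have h₁ : e₁ * Q.i₁ = Q.C ^ 2 := by
    rw [he₁]; linear_combination Q.C ^ 2 * Q.h₁ - Q.i₁ * Q.hC
  have h₂ : e₂ * Q.i₂ = Q.C ^ 2 := by
    rw [he₂]; linear_combination Q.C ^ 2 * Q.h₂ - 2 * Q.i₂ * Q.hC
  have hD : d * Q.iD = Q.C ^ 4 := by
    rw [hd]
    linear_combination Q.C ^ 4 * Q.hD +
      Q.iD * (-3 * Q.C ^ 2 + Q.C - 1 + Q.z * Q.C ^ 2) * Q.hC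
  have hR : t * Q.iR = Q.C := by
    rw [ht]; linear_combination Q.C * Q.hR - 2 * Q.iR * Q.hC
  have n₁ : e₁ ≠ 0 := left_ne_zero_of_mul (h₁ ▸ pow_ne_zero 2 hC)
  have n₂ : e₂ ≠ 0 := left_ne_zero_of_mul (h₂ ▸ pow_ne_zero 2 hC)
  have nD : d ≠ 0 := left_ne_zero_of_mul (hD ▸ pow_ne_zero 4 hC)
  have nR : t ≠ 0 := left_ne_zero_of_mul (hR ▸ hC)
  have k₁ : Q.i₁ = Q.C ^ 2 / e₁ := by rw [eq_div_iff n₁, mul_comm, h₁]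
  have k₂ : Q.i₂ = Q.C ^ 2 / e₂ := by rw [eq_div_iff n₂, mul_comm, h₂]
  have kD : Q.iD = Q.C ^ 4 / d := by rw [eq_div_iff nD, mul_comm, hD]
  have kR : Q.iR = Q.C / t := by rw [eq_div_iff nR, mul_comm, hR]
  have hr : Q.r = e₁ / e₂ := by
    rw [r, k₂, z_eq]; field_simp; rw [he₁]; ring
  have hp : Q.p = -(e₁ * e₂ / d) := by
    rw [p, kD, z_eq]; field_simp; rw [he₁, he₂]; ring
  have hl : Q.lam = (Q.C ^ 4 - 4 * Q.C ^ 3 + 7 * Q.C ^ 2 - 5 * Q.C + 2) / (t * d) := by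
    rw [lam, hp, hr, kR, z_eq]; field_simp; rw [he₁, hd]; ring
  have hk : Q.kap = (Q.C - 1) ^ 4 * e₁ *
      (2 * Q.C ^ 4 - 6 * Q.C ^ 3 + 8 * Q.C ^ 2 - 5 * Q.C + 2) / (Q.C * t * d ^ 2) := by
    rw [kap, hp, hl, kD, k₁, z_eq]; field_simp; rw [he₁, he₂, hd, ht]; ring
  have hU : Q.U = (Q.C - 1) ^ 4 * e₁ ^ 2 * Q.C / d ^ 2 := by
    rw [U, kD, z_eq]; field_simp; rw [he₁]; ring
  exact ⟨e₁, e₂, d, t, ⟨n₁, n₂, nD, nR⟩, ⟨he₁, he₂, hd, ht⟩, ⟨k₁, kD, hr, hp⟩, hl, hk, hU⟩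

theorem gf_Y_eq (ε : Bool) (a b c : ℕ) : Q.gf ε (.Y a b c) =
    Q.z + Q.z * (((State.Y a b c).children ε).map (Q.gf ε)).sum := by
  have h := Q.sum_Y ε a b c
  simp only [State.children, List.map_cons, List.map_map, Function.comp_def, List.sum_cons,
    List.map_append, List.sum_append, sum_gf_W, sum_gf_W_shift, List.map_nil, List.sum_nil,
    mul_add, h]
  have hC := Q.C_ne_zero
  obtain ⟨e₁, e₂, d, t, ⟨n₁, -, -, -⟩, ⟨he₁, -, -, -⟩, ⟨k₁, -, -, -⟩, -⟩ := Q.exists_rational_form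
  cases ε <;> simp only [gf, del, if_true, if_false, Bool.false_eq_true, Bool.toNat_true,
    Bool.toNat_false, pow_add, k₁, z_eq] <;> field_simp <;>
    (try simp only [he₁]) <;> ring

theorem gf_X_eq (ε : Bool) (a b c : ℕ) : Q.gf ε (.X a b c) =
    Q.z + Q.z * (((State.X a b c).children ε).map (Q.gf ε)).sum := by
  have h := Q.sum_Y ε a b c
  simp only [State.children, List.map_cons, List.map_map, Function.comp_def, List.sum_cons,
    List.map_append, List.sum_append, sum_gf_W, sum_gf_W_shift, List.map_nil, List.sum_nil,
    mul_add, h]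
  have hC := Q.C_ne_zero
  obtain ⟨e₁, e₂, d, t, ⟨n₁, n₂, nD, nR⟩, ⟨he₁, he₂, hd, ht⟩, ⟨k₁, kD, hr, hp⟩, hl, hk, hU⟩ :=
    Q.exists_rational_form
  cases ε <;> simp only [gf, del, S, if_true, if_false, Bool.false_eq_true, Bool.toNat_true,
    Bool.toNat_false, pow_add, Finset.sum_range_one, Nat.cast_one, pow_one, pow_zero] <;>
    generalize Q.C ^ a = x, Q.C ^ b = y, Q.C ^ c = w, Q.r ^ c = v <;>
    simp only [hk, hl, hp, hr, k₁, kD, hU, z_eq] <;> field_simp <;>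
    simp only [he₁, he₂, hd, ht] <;> ring

theorem gf_V_eq (ε : Bool) (a b : ℕ) : Q.gf ε (.V a b) =
    Q.z + Q.z * (((State.V a b).children ε).map (Q.gf ε)).sum := by
  simp only [State.children, List.map_cons, List.map_map, Function.comp_def, List.sum_cons,
    List.map_append, List.sum_append, sum_gf_W, sum_gf_X, List.map_nil, List.sum_nil]
  have hC := Q.C_ne_zero
  obtain ⟨e₁, e₂, d, t, ⟨n₁, n₂, nD, nR⟩, ⟨he₁, he₂, hd, ht⟩, ⟨k₁, kD, hr, hp⟩, hl, hk, hU⟩ :=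
    Q.exists_rational_form
  have hS : Q.S (a + 1) = Q.S a + Q.C ^ a * Q.C := by
    rw [S, Finset.sum_range_succ, pow_succ, S]
  cases ε <;> simp only [gf, del, hS, if_true, if_false, Bool.false_eq_true, pow_add,
    Nat.cast_add, Nat.cast_one, pow_one] <;>
    generalize Q.C ^ a = x, Q.C ^ b = y, Q.S a = s <;>
    simp only [hk, hl, hp, hr, k₁, kD, hU, z_eq] <;> field_simp <;>
    simp only [he₁, he₂, hd, ht] <;> ring

theorem gf_eq (ε : Bool) (s : State) :
    Q.gf ε s = Q.z + Q.z * ((s.children ε).map (Q.gf ε)).sum := by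
  cases s with
  | W m => exact Q.gf_W_eq ε m
  | Y a b c => exact Q.gf_Y_eq ε a b c
  | X a b c => exact Q.gf_X_eq ε a b c
  | V a b => exact Q.gf_V_eq ε a b

end Field

/-- The functional equations of the generating tree, descended from the fraction field. -/
theorem gf_eq_of_isDomain [IsDomain A] (ε : Bool) (s : State) :
    P.gf ε s = P.z + P.z * ((s.children ε).map (P.gf ε)).sum := by
  have hf := IsFractionRing.injective A (FractionRing A)
  refine hf ?_
  have h := (P.map (algebraMap A (FractionRing A))).gf_eq ε s
  rw [gf_map] at h
  rw [h, map_add, map_mul, map_list_sum, List.map_map]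
  congr 4
  exact funext fun t => P.gf_map _ ε t

end Params

/-! ### The generating function -/

namespace Params
variable {K : Type*} [Field K] (Q : Params K)

/-- The closed form of the series of the root, with `1 - 2zC` in place of `√(1 - 4z)`. -/
theorem gf_root_field :
    (1 + Q.gf false (.X 0 0 0)) * (2 * (1 - 2 * Q.z * Q.C) * (1 - 3 * Q.z + Q.z ^ 2) ^ 2) =
      3 - 22 * Q.z + 54 * Q.z ^ 2 - 54 * Q.z ^ 3 + 25 * Q.z ^ 4 - 4 * Q.z ^ 5 -
        (1 - 6 * Q.z + 14 * Q.z ^ 2 - 16 * Q.z ^ 3 + 5 * Q.z ^ 4) * (1 - 2 * Q.z * Q.C) := by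
  have hC := Q.C_ne_zero
  obtain ⟨e₁, e₂, d, t, ⟨n₁, n₂, nD, nR⟩, ⟨he₁, he₂, hd, ht⟩, ⟨k₁, kD, hr, hp⟩, hl, hk, hU⟩ :=
    Q.exists_rational_form
  simp only [gf, Bool.false_eq_true, if_false, add_zero, pow_zero, mul_one, hk, hl, hp, z_eq]
  field_simp
  simp only [he₁, he₂, hd, ht]
  ring

variable {A : Type*} [CommRing A] (P : Params A)

theorem gf_root [IsDomain A] :
    (1 + P.gf false (.X 0 0 0)) * (2 * (1 - 2 * P.z * P.C) * (1 - 3 * P.z + P.z ^ 2) ^ 2) =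
      3 - 22 * P.z + 54 * P.z ^ 2 - 54 * P.z ^ 3 + 25 * P.z ^ 4 - 4 * P.z ^ 5 -
        (1 - 6 * P.z + 14 * P.z ^ 2 - 16 * P.z ^ 3 + 5 * P.z ^ 4) * (1 - 2 * P.z * P.C) := by
  refine IsFractionRing.injective A (FractionRing A) ?_
  have h := (P.map (algebraMap A (FractionRing A))).gf_root_field
  rw [gf_map] at h
  have hn (n : ℕ) [n.AtLeastTwo] : algebraMap A (FractionRing A) ofNat(n) = ofNat(n) :=
    map_ofNat _ n
  simpa [map, hn 2, hn 3, hn 4, hn 5, hn 6, hn 14, hn 16, hn 22, hn 25, hn 54] using h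

/-- Allowing 31524 adds only terms in which `√(1 - 4z)` stands in the numerator. -/
theorem gf_root_sub : P.gf true (.X 0 0 0) - P.gf false (.X 0 0 0) = P.z * P.U := by
  simp [gf, del]

/-- The gain from allowing 31524, decomposed with respect to `1` and `√(1 - 4z) = 1 - 2zC`. -/
theorem four_mul_z_mul_U : 4 * (P.z * P.U) =
    ((1 - P.z) ^ 3 * ((1 - 2 * P.z) ^ 2 + 1 - 4 * P.z)
        - 2 * (1 - P.z) ^ 2 * P.z ^ 2 * (1 - 2 * P.z)) * P.iD ^ 2 +
      ((1 - P.z) ^ 2 * (2 * P.z ^ 2 - 2 * (1 - P.z) * (1 - 2 * P.z))) * P.iD ^ 2 *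
        (1 - 2 * P.z * P.C) := by
  simp only [U]
  linear_combination (-P.z * (1 - P.z) ^ 2 * P.iD ^ 2 * (4 * (1 - P.z) *
    (P.z ^ 2 * P.C ^ 2 + P.z * P.C - P.z + 1) - 4 * P.z ^ 2)) * P.hC

end Params

open PowerSeries in
/-- The concrete choice in `ℚ⟦X⟧`: `C` is the Catalan series. -/
noncomputable def seriesParams : Params ℚ⟦X⟧ where
  z := X
  C := PowerSeries.map (Nat.castRingHom ℚ) catalanSeries
  i₁ := (1 - X)⁻¹
  i₂ := (1 - 2 * X)⁻¹
  iD := (1 - 3 * X + X ^ 2)⁻¹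
  iR := (1 - 2 * X * PowerSeries.map (Nat.castRingHom ℚ) catalanSeries)⁻¹
  hC := by
    conv_lhs => rw [← catalanSeries_sq_mul_X_add_one]
    simp only [map_add, map_mul, map_pow, map_one, PowerSeries.map_X]
    ring
  h₁ := PowerSeries.mul_inv_cancel _ (by simp)
  h₂ := PowerSeries.mul_inv_cancel _ (by simp)
  hD := PowerSeries.mul_inv_cancel _ (by simp)
  hR := PowerSeries.mul_inv_cancel _ (by simp)

/-- Both sides are square roots of `1 - 4z` with constant term `1`. -/
theorem one_sub_two_mul_catalan : 1 - 2 * seriesParams.z * seriesParams.C = sqrtOneSubFourX := by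
  set s := 1 - 2 * seriesParams.z * seriesParams.C with hs
  have h1 : s ^ 2 = 1 - 4 * PowerSeries.X := by
    have := seriesParams.hC
    have hz : seriesParams.z = PowerSeries.X := rfl
    rw [hs, ← hz]
    linear_combination (-4 * seriesParams.z) * this
  have h2 : (s - sqrtOneSubFourX) * (s + sqrtOneSubFourX) = 0 := by
    linear_combination h1 - sqrtOneSubFourX_sq
  have h3 : s + sqrtOneSubFourX ≠ 0 := fun h => by
    have := congrArg PowerSeries.constantCoeff h
    rw [map_add, constantCoeff_sqrtOneSubFourX] at this
    simp [hs, seriesParams] at this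
  exact sub_eq_zero.1 ((mul_eq_zero.1 h2).resolve_right h3)

open PowerSeries in
theorem constantCoeff_gf (ε : Bool) (s : State) :
    constantCoeff (seriesParams.gf ε s) = 0 := by
  have hz : constantCoeff seriesParams.z = (0 : ℚ) := by simp [seriesParams]
  rw [Params.gf_eq_of_isDomain, map_add, map_mul, hz]
  simp

open PowerSeries in
/-- The functional equations determine all coefficients, level by level. -/
theorem coeff_gf (ε : Bool) (k : ℕ) (s : State) :
    coeff (k + 1) (seriesParams.gf ε s) = (s.count ε k : ℚ) := by
  have hz : seriesParams.z = (X : ℚ⟦X⟧) := rfl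
  induction k generalizing s with
  | zero =>
    rw [Params.gf_eq_of_isDomain, hz, map_add, coeff_succ_X_mul, map_list_sum, List.map_map,
      List.sum_eq_zero]
    · simp [State.count]
    · simp only [List.mem_map, Function.comp]
      rintro _ ⟨t, -, rfl⟩
      simpa using constantCoeff_gf ε t
  | succ k ih =>
    rw [Params.gf_eq_of_isDomain, hz, map_add, coeff_succ_X_mul, map_list_sum, List.map_map,
      State.count, Nat.cast_list_sum, List.map_map]
    simp only [Function.comp_def, ih]
    simp [coeff_X]

/-- The generating function of the class in terms of the root of the generating tree. -/
theorem permGenFun_eq (ε : Bool) :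
    permGenFun (Av (basis ε)) = 1 + seriesParams.gf ε (.X 0 0 0) := by
  ext n
  rw [permGenFun, PowerSeries.coeff_mk, map_add]
  cases n with
  | zero => simp [permCount_zero, constantCoeff_gf]
  | succ k => rw [permCount_succ, coeff_gf]; simp [PowerSeries.coeff_one]

theorem permGenFun_closed_form :
    permGenFun (Av {p4123, p1324, p31524}) =
        (3 - 22 * PowerSeries.X + 54 * PowerSeries.X ^ 2 - 54 * PowerSeries.X ^ 3
            + 25 * PowerSeries.X ^ 4 - 4 * PowerSeries.X ^ 5
          - (1 - 6 * PowerSeries.X + 14 * PowerSeries.X ^ 2 - 16 * PowerSeries.X ^ 3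
              + 5 * PowerSeries.X ^ 4) * sqrtOneSubFourX) *
        (2 * sqrtOneSubFourX * (1 - 3 * PowerSeries.X + PowerSeries.X ^ 2) ^ 2)⁻¹ := by
  rw [PowerSeries.eq_mul_inv_iff_mul_eq (by
    simp only [map_mul, constantCoeff_sqrtOneSubFourX, map_ofNat (PowerSeries.constantCoeff (R := ℚ)) 2]
    simp)]
  have h := seriesParams.gf_root
  rw [one_sub_two_mul_catalan] at h
  exact (congrArg (· * _) (permGenFun_eq false)).trans h

/-! ### Asymptotics of coefficients -/

section Asymptotics
open Filter Topology

/-- A power series whose coefficients are summable against `3⁻ⁿ`; in particular it converges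
in a disc of radius larger than `1 / 4`. -/
def SummableThree (g : ℝ⟦X⟧) : Prop :=
  Summable fun n => |PowerSeries.coeff n g| * (1 / 3) ^ n

/-- The value of a power series at `1 / 4`. -/
noncomputable def evalQuarter (g : ℝ⟦X⟧) : ℝ := ∑' n, PowerSeries.coeff n g * (1 / 4) ^ n

namespace SummableThree
variable {g h : ℝ⟦X⟧}

theorem summable_norm_quarter (hg : SummableThree g) :
    Summable fun n => ‖PowerSeries.coeff n g * (1 / 4 : ℝ) ^ n‖ := by
  refine hg.of_nonneg_of_le (fun _ => norm_nonneg _) fun n => ?_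
  rw [norm_mul, Real.norm_eq_abs, norm_pow, Real.norm_of_nonneg (by norm_num)]
  gcongr
  norm_num

theorem coeff_mul_pow (x : ℝ) (n : ℕ) : PowerSeries.coeff n (g * h) * x ^ n =
    ∑ kl ∈ Finset.HasAntidiagonal.antidiagonal n,
      (PowerSeries.coeff kl.1 g * x ^ kl.1) * (PowerSeries.coeff kl.2 h * x ^ kl.2) := by
  rw [PowerSeries.coeff_mul, Finset.sum_mul]
  refine Finset.sum_congr rfl fun kl hkl => ?_
  rw [← Finset.HasAntidiagonal.mem_antidiagonal.1 hkl, pow_add]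
  ring

theorem norm_eq (n : ℕ) : ‖PowerSeries.coeff n g * (1 / 3 : ℝ) ^ n‖ =
    |PowerSeries.coeff n g| * (1 / 3) ^ n := by
  rw [norm_mul, Real.norm_eq_abs, norm_pow, Real.norm_of_nonneg (by norm_num)]

theorem mul (hg : SummableThree g) (hh : SummableThree h) : SummableThree (g * h) := by
  have := summable_norm_sum_mul_antidiagonal_of_summable_norm
    (f := fun n => PowerSeries.coeff n g * (1 / 3 : ℝ) ^ n)
    (g := fun n => PowerSeries.coeff n h * (1 / 3 : ℝ) ^ n)
    (by simpa only [norm_eq, SummableThree] using hg)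
    (by simpa only [norm_eq, SummableThree] using hh)
  simpa only [← coeff_mul_pow, norm_eq, SummableThree] using this

theorem evalQuarter_mul (hg : SummableThree g) (hh : SummableThree h) :
    evalQuarter (g * h) = evalQuarter g * evalQuarter h := by
  unfold evalQuarter
  rw [tsum_mul_tsum_eq_tsum_sum_antidiagonal_of_summable_norm hg.summable_norm_quarter
    hh.summable_norm_quarter]
  simp only [coeff_mul_pow]

theorem polynomial (p : Polynomial ℝ) : SummableThree (p : ℝ⟦X⟧) := by
  refine summable_of_ne_finset_zero (s := p.support) fun n hn => ?_
  rw [Polynomial.coeff_coe, Polynomial.notMem_support_iff.1 hn]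
  simp

theorem geometric {a : ℝ} (ha : 0 ≤ a) (ha' : a < 3) :
    SummableThree (PowerSeries.mk fun n => a ^ n) := by
  unfold SummableThree
  simp only [PowerSeries.coeff_mk, abs_pow, abs_of_nonneg ha, ← mul_pow]
  exact summable_geometric_of_lt_one (by positivity) (by linarith)

end SummableThree

theorem evalQuarter_polynomial (p : Polynomial ℝ) : evalQuarter (p : ℝ⟦X⟧) = p.eval (1 / 4) := by
  rw [Polynomial.eval_eq_sum, Polynomial.sum, evalQuarter, tsum_eq_sum (s := p.support)]
  · simp
  · intro n hn
    rw [Polynomial.coeff_coe, Polynomial.notMem_support_iff.1 hn, zero_mul]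

theorem one_sub_mul_geometric (a : ℝ) :
    (1 - PowerSeries.C a * PowerSeries.X) * PowerSeries.mk (fun n => a ^ n) = 1 := by
  ext n
  rw [sub_mul, one_mul, map_sub, mul_assoc, PowerSeries.coeff_C_mul]
  cases n with
  | zero => simp
  | succ n => simp [PowerSeries.coeff_succ_X_mul, PowerSeries.coeff_one, pow_succ, mul_comm]

/-- The reciprocal of `1 - 3z + z²` has radius of convergence `(3 - √5) / 2 > 1 / 3`. -/
theorem summableThree_of_mul_eq_one {g : ℝ⟦X⟧}
    (hg : (1 - 3 * PowerSeries.X + PowerSeries.X ^ 2) * g = 1) : SummableThree g := by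
  have h5 : √5 ^ 2 = 5 := Real.sq_sqrt (by norm_num)
  have h5' : √5 < 3 := by rw [Real.sqrt_lt' (by norm_num)]; norm_num
  have h0 := Real.sqrt_nonneg 5
  set a := (3 + √5) / 2 with ha
  set b := (3 - √5) / 2 with hb
  have h1 := one_sub_mul_geometric a
  have h2 := one_sub_mul_geometric b
  have hab : (PowerSeries.C a + PowerSeries.C b : ℝ⟦X⟧) = 3 := by
    rw [← map_add, show a + b = 3 by rw [ha, hb]; ring]; exact map_ofNat _ 3
  have hab' : (PowerSeries.C a * PowerSeries.C b : ℝ⟦X⟧) = 1 := by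
    rw [← map_mul, show a * b = 1 by rw [ha, hb]; linear_combination (-1 / 4) * h5, map_one]
  have key : g = PowerSeries.mk (fun n => a ^ n) * PowerSeries.mk (fun n => b ^ n) := by
    set u := PowerSeries.mk (fun n => a ^ n)
    set v := PowerSeries.mk (fun n => b ^ n)
    have hu : (1 - 3 * PowerSeries.X + PowerSeries.X ^ 2) * (u * v) = 1 := by
      linear_combination h1 * ((1 - PowerSeries.C b * PowerSeries.X) * v) + h2 +
        PowerSeries.X * u * v * hab - PowerSeries.X ^ 2 * u * v * hab'
    calc g = g * ((1 - 3 * PowerSeries.X + PowerSeries.X ^ 2) * (u * v)) := by rw [hu, mul_one]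
      _ = ((1 - 3 * PowerSeries.X + PowerSeries.X ^ 2) * g) * (u * v) := by ring
      _ = u * v := by rw [hg, one_mul]
  rw [key]
  exact (SummableThree.geometric (by linarith) (by linarith)).mul
    (.geometric (by linarith) (by linarith))

theorem three_pow_mul_centralBinom_le (m k : ℕ) :
    2 * (3 ^ k * m.centralBinom) ≤ 3 * (m + k).centralBinom := by
  induction k with
  | zero => simp; omega
  | succ k ih =>
    rcases Nat.eq_zero_or_pos (m + k) with h | h
    · -- The ratio `binom(2, 1) / binom(0, 0)` is only `2`, hence the factor `3 / 2`.
      obtain ⟨rfl, rfl⟩ : m = 0 ∧ k = 0 := by omega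
      decide
    · have h1 := Nat.succ_mul_centralBinom_succ (m + k)
      have h2 : 3 * (m + k).centralBinom ≤ (m + k + 1).centralBinom := by
        refine Nat.le_of_mul_le_mul_left (c := m + k + 1) ?_ (by omega)
        rw [h1]
        nlinarith [(m + k).centralBinom_pos]
      rw [← add_assoc, pow_succ]
      linarith

theorem centralBinom_div_le (m k : ℕ) :
    (m.centralBinom : ℝ) / (m + k).centralBinom ≤ 3 / 2 * (1 / 3) ^ k := by
  have h : (2 : ℝ) * (3 ^ k * m.centralBinom) ≤ 3 * (m + k).centralBinom := by
    exact_mod_cast three_pow_mul_centralBinom_le m k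
  have hp : (0 : ℝ) < (m + k).centralBinom := by exact_mod_cast Nat.centralBinom_pos _
  rw [div_le_iff₀ hp, one_div_pow]
  field_simp
  linarith

theorem tendsto_centralBinom_div_succ :
    Tendsto (fun m : ℕ => (m.centralBinom : ℝ) / (m + 1).centralBinom) atTop (𝓝 (1 / 4)) := by
  have h : ∀ m : ℕ, (m.centralBinom : ℝ) / (m + 1).centralBinom =
      1 / 4 + 1 / 4 * (1 / (2 * m + 1)) := by
    intro m
    have h1 : ((m + 1 : ℕ) : ℝ) * (m + 1).centralBinom = 2 * (2 * m + 1) * m.centralBinom := by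
      exact_mod_cast Nat.succ_mul_centralBinom_succ m
    have hp : (0 : ℝ) < (m + 1).centralBinom := by exact_mod_cast Nat.centralBinom_pos _
    push_cast at h1
    field_simp
    linear_combination -2 * h1
  simp only [h]
  have h2 : Tendsto (fun m : ℕ => 1 / (2 * (m : ℝ) + 1)) atTop (𝓝 0) := by
    refine tendsto_const_nhds.div_atTop (tendsto_atTop_add_const_right _ _ ?_)
    exact tendsto_natCast_atTop_atTop.const_mul_atTop (by norm_num)
  have h3 := (h2.const_mul (1 / 4)).const_add (1 / 4)
  rwa [mul_zero, add_zero] at h3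

theorem tendsto_centralBinom_div (k : ℕ) :
    Tendsto (fun m : ℕ => (m.centralBinom : ℝ) / (m + k).centralBinom) atTop
      (𝓝 ((1 / 4) ^ k)) := by
  induction k with
  | zero =>
    refine tendsto_const_nhds.congr fun m => ?_
    have hp : (m.centralBinom : ℝ) ≠ 0 := by exact_mod_cast Nat.centralBinom_ne_zero _
    simp [hp]
  | succ k ih =>
    have h := ih.mul (tendsto_centralBinom_div_succ.comp (tendsto_add_atTop_nat k))
    rw [← pow_succ] at h
    refine h.congr fun m => ?_
    have hp : ((m + k).centralBinom : ℝ) ≠ 0 := by exact_mod_cast Nat.centralBinom_ne_zero _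
    simp only [Function.comp, ← add_assoc]
    field_simp

/-- The series `∑ binom(2n, n) zⁿ = 1 / √(1 - 4z)`. -/
noncomputable def centralBinomSeries : ℝ⟦X⟧ := PowerSeries.mk fun n => (n.centralBinom : ℝ)

/-- Transfer of the singularity at `1 / 4`: by dominated convergence, the coefficients of
`g / √(1 - 4z)` are asymptotic to `g(1 / 4)` times the central binomial coefficients. -/
theorem tendsto_coeff_mul_centralBinomSeries {g : ℝ⟦X⟧} (hg : SummableThree g) :
    Tendsto (fun n => PowerSeries.coeff n (g * centralBinomSeries) / n.centralBinom) atTop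
      (𝓝 (evalQuarter g)) := by
  have key : ∀ n, PowerSeries.coeff n (g * centralBinomSeries) / n.centralBinom =
      ∑' k, if k ≤ n then PowerSeries.coeff k g * ((n - k).centralBinom / n.centralBinom)
        else 0 := by
    intro n
    rw [tsum_eq_sum (s := Finset.range (n + 1)), PowerSeries.coeff_mul,
      Finset.Nat.sum_antidiagonal_eq_sum_range_succ
        (fun i j => PowerSeries.coeff i g * PowerSeries.coeff j centralBinomSeries),
      Finset.sum_div]
    · refine Finset.sum_congr rfl fun k hk => ?_
      rw [if_pos (by simpa [Nat.lt_succ_iff] using hk), centralBinomSeries,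
        PowerSeries.coeff_mk, mul_div_assoc]
    · intro k hk
      exact if_neg (by simpa [Nat.lt_succ_iff] using hk)
  simp only [key]
  refine tendsto_tsum_of_dominated_convergence
    (bound := fun k => 3 / 2 * (|PowerSeries.coeff k g| * (1 / 3) ^ k))
    (Summable.mul_left _ hg) (fun k => ?_) (Eventually.of_forall fun n k => ?_)
  · rw [← tendsto_add_atTop_iff_nat k]
    refine ((tendsto_centralBinom_div k).const_mul _).congr fun m => ?_
    rw [if_pos (by omega), Nat.add_sub_cancel]
  · split_ifs with h
    · obtain ⟨m, rfl⟩ : ∃ m, n = m + k := ⟨n - k, by omega⟩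
      rw [Nat.add_sub_cancel, norm_mul, Real.norm_eq_abs,
        Real.norm_of_nonneg (by positivity)]
      calc _ ≤ |PowerSeries.coeff k g| * (3 / 2 * (1 / 3) ^ k) := by
            gcongr; exact centralBinom_div_le m k
        _ = _ := by ring
    · rw [norm_zero]; positivity

theorem tendsto_coeff_div_centralBinom {h : ℝ⟦X⟧} (hh : SummableThree h) :
    Tendsto (fun n => PowerSeries.coeff n h / n.centralBinom) atTop (𝓝 0) := by
  refine squeeze_zero_norm (a := fun n => 3 / 2 * (|PowerSeries.coeff n h| * (1 / 3) ^ n))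
    (fun n => ?_) (by simpa using (Summable.tendsto_atTop_zero hh).const_mul (3 / 2))
  have := centralBinom_div_le 0 n
  simp only [Nat.centralBinom_zero, Nat.cast_one, zero_add] at this
  rw [norm_div, Real.norm_eq_abs, Real.norm_natCast, div_eq_mul_one_div]
  calc _ ≤ |PowerSeries.coeff n h| * (3 / 2 * (1 / 3) ^ n) := by gcongr
    _ = _ := by ring

end Asymptotics

/-! ### The limit -/

section Limit
open Filter Topology

/-- The concrete choice of parameters, over the real numbers. -/
noncomputable def realParams : Params ℝ⟦X⟧ :=
  seriesParams.map (PowerSeries.map (Rat.castHom ℝ))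

theorem realParams_z : realParams.z = PowerSeries.X := by
  simp [realParams, Params.map, seriesParams]

theorem coeff_realParams_C (n : ℕ) : PowerSeries.coeff n realParams.C = catalan n := by
  simp [realParams, Params.map, seriesParams]

/-- Differentiate `(1 - 2zC)² = 1 - 4z`, and use `(n + 1) Cₙ = binom(2n, n)`. -/
theorem realParams_iR : realParams.iR = centralBinomSeries := by
  have hz := realParams_z
  have hR := realParams.hR
  have hC := realParams.hC
  rw [hz] at hR hC
  obtain ⟨y, hy⟩ : ∃ y : ℝ⟦X⟧, y = PowerSeries.X * realParams.C := ⟨_, rfl⟩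
  have h1 : y = PowerSeries.X + y ^ 2 := by
    rw [hy]; linear_combination PowerSeries.X * hC
  have h2 : PowerSeries.derivative ℝ y = centralBinomSeries := by
    ext n
    rw [PowerSeries.coeff_derivative, hy, PowerSeries.coeff_succ_X_mul, coeff_realParams_C,
      centralBinomSeries, PowerSeries.coeff_mk, ← succ_mul_catalan_eq_centralBinom]
    push_cast
    ring
  have h3 := congrArg (PowerSeries.derivative ℝ) h1
  rw [map_add, sq, Derivation.leibniz, h2, PowerSeries.derivative_X, smul_eq_mul] at h3
  linear_combination centralBinomSeries * hR - realParams.iR * h3 -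
    2 * centralBinomSeries * realParams.iR * hy

theorem cast_permCount (ε : Bool) (n : ℕ) : (permCount (Av (basis ε)) n : ℝ) =
    PowerSeries.coeff n (1 + realParams.gf ε (.X 0 0 0)) := by
  have h := congrArg (fun f => PowerSeries.coeff n (PowerSeries.map (Rat.castHom ℝ) f))
    (permGenFun_eq ε)
  simpa [permGenFun, realParams, Params.gf_map] using h

theorem summableThree_iD_sq : SummableThree (realParams.iD ^ 2) := by
  have h := realParams.hD
  rw [realParams_z] at h
  rw [sq]
  exact (summableThree_of_mul_eq_one h).mul (summableThree_of_mul_eq_one h)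

section Polynomials
open Polynomial

theorem coe_ofNat_polynomial (n : ℕ) [n.AtLeastTwo] :
    ((ofNat(n) : ℝ[X]) : ℝ⟦X⟧) = ofNat(n) :=
  map_ofNat (Polynomial.coeToPowerSeries.ringHom (R := ℝ)) n

/-- With `A` the polynomial part of the numerator of the generating function and `D = 1 - 3z + z²`, the
term that carries the singularity is `A / (2 D² √(1 - 4z))`. As `A(1 / 4) = 1 / 8`, it does not
vanish at `1 / 4`. -/
theorem exists_limit_ne_zero : ∃ l : ℝ, l ≠ 0 ∧
    Tendsto (fun n => (permCount (Av (basis false)) n : ℝ) / n.centralBinom) atTop (𝓝 l) := by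
  obtain ⟨pA, hA⟩ : ∃ p : ℝ[X],
      p = 3 - 22 * X + 54 * X ^ 2 - 54 * X ^ 3 + 25 * X ^ 4 - 4 * X ^ 5 := ⟨_, rfl⟩
  obtain ⟨pB, hB⟩ : ∃ p : ℝ[X], p = 1 - 6 * X + 14 * X ^ 2 - 16 * X ^ 3 + 5 * X ^ 4 := ⟨_, rfl⟩
  obtain ⟨pD, hD⟩ : ∃ p : ℝ[X], p = 1 - 3 * X + X ^ 2 := ⟨_, rfl⟩
  have hs := summableThree_iD_sq
  have hz := realParams_z
  have hDi : (pD * pD * realParams.iD ^ 2 : ℝ⟦X⟧) = 1 := by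
    have h := realParams.hD
    rw [hz] at h
    have hc : (pD : ℝ⟦X⟧) = 1 - 3 * PowerSeries.X + PowerSeries.X ^ 2 := by
      simp [hD, coe_ofNat_polynomial]
    rw [hc]
    linear_combination ((1 - 3 * PowerSeries.X + PowerSeries.X ^ 2) * realParams.iD + 1) * h
  have key : 2 * (1 + realParams.gf false (.X 0 0 0)) =
      (pA * realParams.iD ^ 2) * centralBinomSeries + (-pB : ℝ[X]) * realParams.iD ^ 2 := by
    have h := realParams.gf_root
    have hR := realParams.hR
    have hc : (pD : ℝ⟦X⟧) = 1 - 3 * PowerSeries.X + PowerSeries.X ^ 2 := by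
      simp [hD, coe_ofNat_polynomial]
    have hcA : (pA : ℝ⟦X⟧) = 3 - 22 * PowerSeries.X + 54 * PowerSeries.X ^ 2 -
        54 * PowerSeries.X ^ 3 + 25 * PowerSeries.X ^ 4 - 4 * PowerSeries.X ^ 5 := by
      simp [hA, coe_ofNat_polynomial]
    have hcB : (pB : ℝ⟦X⟧) = 1 - 6 * PowerSeries.X + 14 * PowerSeries.X ^ 2 -
        16 * PowerSeries.X ^ 3 + 5 * PowerSeries.X ^ 4 := by
      simp [hB, coe_ofNat_polynomial]
    rw [hz] at h hR
    rw [← hc, ← hcA, ← hcB] at h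
    rw [realParams_iR] at hR
    rw [Polynomial.coe_neg]
    set G := 1 + realParams.gf false (.X 0 0 0)
    set s := 1 - 2 * PowerSeries.X * realParams.C
    linear_combination (realParams.iD ^ 2 * centralBinomSeries) * h +
      (-2 * G - pB * realParams.iD ^ 2) * hR - 2 * G * s * centralBinomSeries * hDi
  have hAs := (SummableThree.polynomial pA).mul hs
  have h1 := (tendsto_coeff_mul_centralBinomSeries hAs).add
    (tendsto_coeff_div_centralBinom ((SummableThree.polynomial (-pB)).mul hs))
  refine ⟨evalQuarter (pA * realParams.iD ^ 2) / 2, ?_, ?_⟩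
  · intro h0
    have h2 := SummableThree.evalQuarter_mul
      ((SummableThree.polynomial pD).mul (.polynomial pD)) hAs
    rw [show ((pD : ℝ⟦X⟧) * pD) * (pA * realParams.iD ^ 2) = pA by
      linear_combination (pA : ℝ⟦X⟧) * hDi, evalQuarter_polynomial] at h2
    rw [div_eq_zero_iff.1 h0 |>.resolve_right two_ne_zero, mul_zero, hA] at h2
    norm_num at h2
  · rw [add_zero] at h1
    refine (h1.div_const 2).congr fun n => ?_
    rw [← add_div, ← map_add, ← key, two_mul, map_add, ← two_mul, cast_permCount]
    ring

/-- The difference of the two generating functions contains `√(1 - 4z) = (1 - 4z) / √(1 - 4z)` only in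
the numerator, and `1 - 4z` vanishes at `1 / 4`. -/
theorem tendsto_sub_div_centralBinom :
    Tendsto (fun n => ((permCount (Av (basis true)) n : ℝ) - permCount (Av (basis false)) n) /
      n.centralBinom) atTop (𝓝 0) := by
  obtain ⟨p, hp⟩ : ∃ p : ℝ[X], p = (1 - X) ^ 3 * ((1 - 2 * X) ^ 2 + 1 - 4 * X)
        - 2 * (1 - X) ^ 2 * X ^ 2 * (1 - 2 * X) := ⟨_, rfl⟩
  obtain ⟨q, hq⟩ : ∃ q : ℝ[X], q = (1 - X) ^ 2 * (2 * X ^ 2 - 2 * (1 - X) * (1 - 2 * X)) :=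
    ⟨_, rfl⟩
  obtain ⟨w, hw⟩ : ∃ w : ℝ[X], w = 1 - 4 * X := ⟨_, rfl⟩
  have hs := summableThree_iD_sq
  have hz := realParams_z
  have key : 4 * (realParams.gf true (.X 0 0 0) - realParams.gf false (.X 0 0 0)) =
      ((q * realParams.iD ^ 2) * w) * centralBinomSeries + p * realParams.iD ^ 2 := by
    have hR := realParams.hR
    have hC := realParams.hC
    have hcp : (p : ℝ⟦X⟧) = (1 - PowerSeries.X) ^ 3 *
        ((1 - 2 * PowerSeries.X) ^ 2 + 1 - 4 * PowerSeries.X) -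
        2 * (1 - PowerSeries.X) ^ 2 * PowerSeries.X ^ 2 * (1 - 2 * PowerSeries.X) := by
      simp [hp, coe_ofNat_polynomial]
    have hcq : (q : ℝ⟦X⟧) = (1 - PowerSeries.X) ^ 2 *
        (2 * PowerSeries.X ^ 2 - 2 * (1 - PowerSeries.X) * (1 - 2 * PowerSeries.X)) := by
      simp [hq, coe_ofNat_polynomial]
    have hcw : (w : ℝ⟦X⟧) = 1 - 4 * PowerSeries.X := by
      simp [hw, coe_ofNat_polynomial]
    rw [realParams.gf_root_sub, realParams.four_mul_z_mul_U]
    rw [hz] at hR hC ⊢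
    rw [← hcp, ← hcq]
    rw [realParams_iR] at hR
    have hw' : (1 - 2 * PowerSeries.X * realParams.C) ^ 2 = (w : ℝ⟦X⟧) := by
      rw [hcw]
      linear_combination (-4 * PowerSeries.X) * hC
    rw [← hw']
    linear_combination (-q * realParams.iD ^ 2 * (1 - 2 * PowerSeries.X * realParams.C)) * hR
  have hqs := (SummableThree.polynomial q).mul hs
  have h1 := (tendsto_coeff_mul_centralBinomSeries (hqs.mul (.polynomial w))).add
    (tendsto_coeff_div_centralBinom ((SummableThree.polynomial p).mul hs))
  have h0 : evalQuarter ((q * realParams.iD ^ 2) * w) = 0 := by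
    rw [SummableThree.evalQuarter_mul hqs (.polynomial w), evalQuarter_polynomial, hw]
    norm_num
  rw [h0, add_zero] at h1
  have h2 := h1.div_const 4
  rw [zero_div] at h2
  refine h2.congr fun n => ?_
  rw [← add_div, ← map_add, ← key, cast_permCount, cast_permCount, map_add, map_add,
    show (4 : ℝ⟦X⟧) = PowerSeries.C 4 from (map_ofNat _ 4).symm, PowerSeries.coeff_C_mul, map_sub]
  ring

end Polynomials

theorem tendsto_permCount_div :
    Tendsto (fun n : ℕ => (permCount (Av {p4123, p1324, p31524}) n : ℝ) /
      (permCount (Av {p4123, p1324}) n : ℝ)) atTop (𝓝 1) := by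
  obtain ⟨l, hl, h1⟩ := exists_limit_ne_zero
  have h2 := h1.add tendsto_sub_div_centralBinom
  rw [add_zero] at h2
  have h3 := h1.div h2 hl
  rw [div_self hl] at h3
  refine h3.congr fun n => ?_
  have hp : (n.centralBinom : ℝ) ≠ 0 := by exact_mod_cast Nat.centralBinom_ne_zero _
  simp only [Pi.div_apply]
  rw [← add_div, add_sub_cancel, div_div_div_cancel_right₀ hp]
  rfl

end Limit

theorem mainTheorem8 :
    permGenFun (Av {p4123, p1324, p31524}) =
        (3 - 22 * PowerSeries.X + 54 * PowerSeries.X ^ 2 - 54 * PowerSeries.X ^ 3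
            + 25 * PowerSeries.X ^ 4 - 4 * PowerSeries.X ^ 5
          - (1 - 6 * PowerSeries.X + 14 * PowerSeries.X ^ 2 - 16 * PowerSeries.X ^ 3
              + 5 * PowerSeries.X ^ 4) * sqrtOneSubFourX) *
        (2 * sqrtOneSubFourX * (1 - 3 * PowerSeries.X + PowerSeries.X ^ 2) ^ 2)⁻¹ ∧
      Av {p4123, p1324, p3124} ⊂ Av {p4123, p1324, p31524} ∧
      Av {p4123, p1324, p1423} ⊂ Av {p4123, p1324, p31524} ∧
      Av {p4123, p1324, p31524} ⊂ Av {p4123, p1324} ∧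
      Filter.Tendsto
        (fun n : ℕ => (permCount (Av {p4123, p1324, p31524}) n : ℝ) /
          (permCount (Av {p4123, p1324}) n : ℝ))
        Filter.atTop (nhds 1) :=
  ⟨permGenFun_closed_form, av_p3124_ssubset, av_p1423_ssubset, av_p31524_ssubset,
    tendsto_permCount_div⟩
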